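/- Let $k\ge 1$ be an odd integer, let $\nu\in\mathbb{C}$ with $\Re(\nu)>0$, let $a,x>0$ be real, and let $0<\theta,\psi<1$ be real. Let $K_\nu$ denote the modified Bessel function of the second kind, i.e. $K_\nu(z)=\frac{\pi}{2}\,\frac{I_{-\nu}(z)-I_\nu(z)}{\sin \pi\nu}$ for $\nu\notin\mathbb{Z}$, where $I_\nu(z)=\sum_{n\ge 0}\frac{(z/2)^{\nu+2n}}{n!\,\Gamma(\nu+n+1)}$, and for $\nu\in\mathbb{Z}$ the limit of this expression as the order tends to $\nu$. Let $\zeta(s,\alpha)=\sum_{n\ge0}(n+\alpha)^{-s}$ ($\Re(s)>1$, $0<\alpha<1$) denote the Hurwitz zeta function. Then $$ \begin{aligned} &\left(\frac{a^2x}{4}\right)^{\frac{\nu}{2}+k+1}\sum_{n=1}^{\infty} n^{\nu/2}K_\nu(a\sqrt{nx})\sum_{d\mid n}d^k\cos(2\pi d\theta)\cos\!\left(\frac{2\pi n\psi}{d}\right)\\ &=\frac{(-1)^{\frac{k-1}{2}}a^{2k+2}\,k!}{2^{2k+4}(2\pi)^{k+1}}\,\Gamma(\nu)\,\bigl\{\zeta(k+1,\theta)+\zeta(k+1,1-\theta)\bigr\}\,x^{k+1}\\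 &\quad+\frac{(-1)^{\frac{k+1}{2}}}{8}(2\pi)^{k+1}\,\Gamma(\nu+k+1)\sum_{n,m\ge 0}\Biggl\{\frac{(n+\psi)^k}{\left(\frac{16\pi^2}{a^2}\frac{(m+\theta)(n+\psi)}{x}+1\right)^{\nu+k+1}}+\frac{(n+1-\psi)^k}{\left(\frac{16\pi^2}{a^2}\frac{(m+\theta)(n+1-\psi)}{x}+1\right)^{\nu+k+1}}\\ &\qquad\qquad+\frac{(n+\psi)^k}{\left(\frac{16\pi^2}{a^2}\frac{(m+1-\theta)(n+\psi)}{x}+1\right)^{\nu+k+1}}+\frac{(n+1-\psi)^k}{\left(\frac{16\pi^2}{a^2}\frac{(m+1-\theta)(n+1-\psi)}{x}+1\right)^{\nu+k+1}}\Biggr\}, \end{aligned} $$ where the series over $n\ge1$ and the double series over $(n,m)$ both converge absolutely. -/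

import Mathlib

open Filter Topology

noncomputable section

/-- The modified Bessel function of the first kind (Bessel function of imaginary argument),
`I_ν(z) = ∑_{n ≥ 0} (z/2)^(ν+2n) / (n! Γ(ν+n+1))`.  The powers are principal powers; at a pole of
`Γ` the term is `0`, which is the correct value of `1/Γ` there. -/
def besselI (ν z : ℂ) : ℂ :=
  ∑' n : ℕ, (z / 2) ^ (ν + 2 * (n : ℂ)) / ((n.factorial : ℂ) * Complex.Gamma (ν + (n : ℂ) + 1))

/-- The expression `(π/2) (I_{-ν}(z) - I_ν(z)) / sin(πν)`, meaningful for `ν ∉ ℤ`. -/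
def besselKQuot (ν z : ℂ) : ℂ :=
  (Real.pi : ℂ) / 2 * ((besselI (-ν) z - besselI ν z) / Complex.sin ((Real.pi : ℂ) * ν))

open Classical in
/-- The modified Bessel function of the second kind `K_ν(z)`: for `ν ∉ ℤ` it is
`(π/2) (I_{-ν}(z) - I_ν(z)) / sin(πν)`, and for `ν ∈ ℤ` it is the limit of that expression as the
order tends to `ν` (the limit exists for every `z > 0`). -/
def besselK (ν z : ℂ) : ℂ :=
  if ∃ m : ℤ, ν = (m : ℂ) then limUnder (𝓝[≠] ν) (fun μ : ℂ => besselKQuot μ z)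
  else besselKQuot ν z

/-- The weighted divisor sum `∑_{d ∣ n} d^k cos(2π d θ) cos(2π n ψ / d)` (for `n ≥ 1`). -/
def cosCosDivisorSum (k : ℕ) (θ ψ : ℝ) (n : ℕ) : ℝ :=
  ∑ d ∈ n.divisors, (d : ℝ) ^ k * Real.cos (2 * Real.pi * (d : ℝ) * θ) *
    Real.cos (2 * Real.pi * (n : ℝ) * ψ / (d : ℝ))

/-- The term `v^k / ((16π²/a²) (u v / x) + 1)^(ν+k+1)`, for `u, v > 0`. -/
def shiftedTerm (k : ℕ) (ν : ℂ) (a x u v : ℝ) : ℂ :=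
  ((v ^ k : ℝ) : ℂ) /
    ((16 * Real.pi ^ 2 / a ^ 2 * (u * v / x) + 1 : ℝ) : ℂ) ^ (ν + (k : ℂ) + 1)

end

/-! Put `y = a²x/4`. Since `K_ν(z) = ½ (z/2)^(-ν) ∫₀^∞ t^(ν-1) e^(-t - z²/(4t)) dt`, each `n^(ν/2)
K_ν(a√(nx))` is `½ y^(-ν/2)` times the integral with `z²/4 = yn`. Writing `n = de`, the left-hand
series becomes `½ y^(-ν/2) ∫₀^∞ t^(ν-1) e^(-t) Θ(y/t) dt`, where `Θ(q) = ∑_{d,e ≥ 1} d^k cos(2πdθ)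
cos(2πeψ) e^(-qde)`. The theorem is the image of a transformation formula for `Θ` under this
integral.

The formula for `Θ` (`hasSum_pow_mul_cos_mul_cosExpSum`) comes from Poisson summation, used twice.
Poisson in `d` is applied to the even function `|ξ|^k ∑_e cos(2πeψ) e^(-qe|ξ|)`, with `θ` shifting
the frequencies to `m + θ`. Its Fourier transform at `u` is a series over `e` of `cos(2πeψ) (qe ±
2πiu)^(-k-1)`. This series is evaluated by a twisted Lipschitz formula (`hasSum_twisted_lipschitz`),
itself a Poisson summation, which produces the sums `∑ v^k e^(-4π²uv/q)` over `v = n + ψ` and `v = n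
+ 1 - ψ`. The Lipschitz formula also contains an index-zero term, absent from the series over `e`;
subtracting it gives a multiple of `u^(-k-1)`, and summing over `u` gives the two Hurwitz zeta
values. Oddness of `k` makes `i^(k+1)` a real sign.

At `q = y/t` the exponentials integrate against `t^(ν+k) e^(-t)` to `Γ(ν+k+1) / (1 +
4π²uv/y)^(ν+k+1)`, and the zeta part integrates to `Γ(ν)`. All interchanges are justified by
absolute convergence.

The integral representation has to be derived from the definition through `I_{±ν}`. It follows from
constancy of Wronskian-type expressions (`besselSeries_reflection`, `macdonald_wronskian`), and the
case of integer order follows by continuity in the order (`besselK_eq`). -/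

open MeasureTheory Set in
/-- The integral `∫₀^∞ t^(ν-1) exp(-t - y/t) dt`, equal to `2 y^(ν/2) K_ν(2√y)` for `y > 0`. -/
noncomputable def macdonaldIntegral (ν : ℂ) (y : ℝ) : ℂ :=
  mellin (fun t : ℝ => (Real.exp (-t - y / t) : ℂ)) ν

/-! ### The Macdonald integral: convergence, functional equation, recurrence and bounds. -/

section Macdonald

open MeasureTheory Set

/-- A single term of the series of `e^w` bounds it from below. The free exponent `M` is chosen later
to suit each summability estimate. -/
theorem Real.exp_neg_le_factorial_div_pow {w : ℝ} (hw : 0 < w) (M : ℕ) :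
    Real.exp (-w) ≤ M.factorial / w ^ M := by
  have h := Real.pow_div_factorial_le_exp w hw.le M
  have h1 : (0 : ℝ) < M.factorial := by positivity
  rw [Real.exp_neg, inv_le_comm₀ (Real.exp_pos _) (by positivity), inv_div]
  exact h

theorem macdonaldIntegral_eq (ν : ℂ) (y : ℝ) :
    macdonaldIntegral ν y =
      ∫ t in Ioi (0 : ℝ), (t : ℂ) ^ (ν - 1) * (Real.exp (-t - y / t) : ℂ) := by
  simp [macdonaldIntegral, mellin]

/-- The factor `e^(-y/t)` vanishes at `0` faster than any power of `t`, which is why the integral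
converges for every complex order. -/
theorem exp_neg_sub_div_le {y t : ℝ} (hy : 0 < y) (ht : 0 < t) (M : ℕ) :
    Real.exp (-t - y / t) ≤ M.factorial / y ^ M * (t ^ M * Real.exp (-t)) := by
  have h := Real.exp_neg_le_factorial_div_pow (div_pos hy ht) M
  rw [sub_eq_add_neg, Real.exp_add]
  calc _ ≤ Real.exp (-t) * (M.factorial / (y / t) ^ M) := by gcongr
    _ = _ := by rw [div_pow]; field_simp

theorem continuousOn_macdonald_kernel (y : ℝ) :
    ContinuousOn (fun t : ℝ => (Real.exp (-t - y / t) : ℂ)) (Ioi 0) := by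
  apply Complex.continuous_ofReal.comp_continuousOn
  apply Real.continuous_exp.comp_continuousOn
  exact continuousOn_id.neg.sub (continuousOn_const.div continuousOn_id fun t ht => (ne_of_gt ht))

theorem macdonald_kernel_isBigO_atTop {y : ℝ} (hy : 0 < y) :
    (fun t : ℝ => (Real.exp (-t - y / t) : ℂ)) =O[atTop] fun t => Real.exp (-1 * t) := by
  apply Asymptotics.IsBigO.of_bound 1
  filter_upwards [eventually_gt_atTop 0] with t ht
  rw [Complex.norm_real, Real.norm_eq_abs, Real.norm_eq_abs, Real.abs_exp, Real.abs_exp, one_mul]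
  apply Real.exp_le_exp.mpr
  have := div_pos hy ht
  linarith

theorem macdonald_kernel_isBigO_zero {y : ℝ} (hy : 0 < y) (M : ℕ) :
    (fun t : ℝ => (Real.exp (-t - y / t) : ℂ)) =O[𝓝[>] 0] fun t => t ^ (-(-(M : ℝ))) := by
  apply Asymptotics.IsBigO.of_bound (M.factorial / y ^ M)
  filter_upwards [self_mem_nhdsWithin] with t (ht : 0 < t)
  rw [Complex.norm_real, Real.norm_eq_abs, Real.norm_eq_abs, Real.abs_exp, neg_neg,
    Real.rpow_natCast, abs_of_pos (by positivity)]
  refine (exp_neg_sub_div_le hy ht M).trans ?_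
  have : Real.exp (-t) ≤ 1 := Real.exp_le_one_iff.mpr (by linarith)
  have h2 : 0 < t ^ M := by positivity
  gcongr
  nlinarith

theorem macdonald_mellinConvergent {y : ℝ} (hy : 0 < y) (ν : ℂ) :
    MellinConvergent (fun t : ℝ => (Real.exp (-t - y / t) : ℂ)) ν := by
  obtain ⟨M, hM⟩ := exists_nat_gt (-ν.re)
  exact mellinConvergent_of_isBigO_rpow_exp one_pos
    ((continuousOn_macdonald_kernel y).locallyIntegrableOn measurableSet_Ioi)
    (macdonald_kernel_isBigO_atTop hy) (macdonald_kernel_isBigO_zero hy M) (by linarith)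

theorem macdonald_integrableOn {y : ℝ} (hy : 0 < y) (ν : ℂ) :
    IntegrableOn (fun t : ℝ => (t : ℂ) ^ (ν - 1) * (Real.exp (-t - y / t) : ℂ)) (Ioi 0) := by
  simpa [MellinConvergent] using macdonald_mellinConvergent hy ν

theorem differentiable_macdonaldIntegral {y : ℝ} (hy : 0 < y) :
    Differentiable ℂ (fun ν => macdonaldIntegral ν y) := by
  intro ν
  obtain ⟨M, hM⟩ := exists_nat_gt (-ν.re)
  exact mellin_differentiableAt_of_isBigO_rpow_exp one_pos
    ((continuousOn_macdonald_kernel y).locallyIntegrableOn measurableSet_Ioi)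
    (macdonald_kernel_isBigO_atTop hy) (macdonald_kernel_isBigO_zero hy M) (by linarith)

/-- The substitution `t ↦ y/t` exchanges the two terms of the exponent. It is carried out as an
inversion followed by a scaling. -/
theorem macdonaldIntegral_neg {y : ℝ} (hy : 0 < y) (ν : ℂ) :
    macdonaldIntegral ν y = (y : ℂ) ^ ν * macdonaldIntegral (-ν) y := by
  have h1 := mellin_comp_inv (fun t : ℝ => (Real.exp (-t - y / t) : ℂ)) ν
  have h2 := mellin_comp_mul_left (fun t : ℝ => (Real.exp (-t⁻¹ - y / t⁻¹) : ℂ)) ν (inv_pos.mpr hy)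
  have hy' : (y : ℂ) ≠ 0 := by exact_mod_cast hy.ne'
  rw [macdonaldIntegral, macdonaldIntegral, ← h1]
  have h3 : mellin (fun t : ℝ => (Real.exp (-(y⁻¹ * t)⁻¹ - y / (y⁻¹ * t)⁻¹) : ℂ)) ν =
      mellin (fun t : ℝ => (Real.exp (-t - y / t) : ℂ)) ν := by
    congr 1
    funext t
    congr 2
    rw [mul_inv, inv_inv]
    rcases eq_or_ne t 0 with rfl | ht
    · simp
    · field_simp
      ring
  rw [← h3, h2, Complex.ofReal_inv, Complex.inv_cpow _ _ (by
    rw [Complex.arg_ofReal_of_nonneg hy.le]; exact Real.pi_pos.ne), Complex.cpow_neg, inv_inv,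
    smul_eq_mul]

theorem norm_cpow_sub_one {t : ℝ} (ht : 0 < t) (ν : ℂ) :
    ‖(t : ℂ) ^ (ν - 1)‖ = t ^ (ν.re - 1) := by
  rw [Complex.norm_cpow_eq_rpow_re_of_pos ht]; simp

theorem tendsto_macdonaldIntegral_zero {ν : ℂ} (hν : 0 < ν.re) :
    Tendsto (macdonaldIntegral ν) (𝓝[>] 0) (𝓝 (Complex.Gamma ν)) := by
  have h : Tendsto (fun y : ℝ => ∫ t in Ioi (0 : ℝ),
      (t : ℂ) ^ (ν - 1) * (Real.exp (-t - y / t) : ℂ)) (𝓝[>] 0)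
      (𝓝 (∫ t in Ioi (0 : ℝ), (t : ℂ) ^ (ν - 1) * (Real.exp (-t) : ℂ))) := by
    apply tendsto_integral_filter_of_dominated_convergence
      (fun t : ℝ => Real.exp (-t) * t ^ (ν.re - 1))
    · filter_upwards [self_mem_nhdsWithin] with y hy
      exact (macdonald_integrableOn hy ν).aestronglyMeasurable
    · filter_upwards [self_mem_nhdsWithin] with y (hy : 0 < y)
      filter_upwards [ae_restrict_mem measurableSet_Ioi] with t (ht : 0 < t)
      rw [norm_mul, norm_cpow_sub_one ht, Complex.norm_real, Real.norm_eq_abs, Real.abs_exp,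
        mul_comm]
      have : Real.exp (-t - y / t) ≤ Real.exp (-t) := by
        apply Real.exp_le_exp.mpr
        have := div_pos hy ht
        linarith
      gcongr
    · exact Real.GammaIntegral_convergent hν
    · filter_upwards with t
      apply Tendsto.const_mul
      have : Continuous fun y : ℝ => (Real.exp (-t - y / t) : ℂ) := by fun_prop
      simpa using (this.tendsto 0).mono_left nhdsWithin_le_nhds
  rw [Complex.Gamma_eq_integral hν, Complex.GammaIntegral]
  simp only [mul_comm] at h ⊢
  convert h using 1
  funext y
  rw [macdonaldIntegral_eq]

/-- Differentiation under the integral sign brings down `-1/t`, lowering the order by one. On the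
neighbourhood `z > y/2` the derivative is dominated by its integrand at `y/2`. -/
theorem hasDerivAt_macdonaldIntegral {y : ℝ} (hy : 0 < y) (ν : ℂ) :
    HasDerivAt (macdonaldIntegral ν) (-macdonaldIntegral (ν - 1) y) y := by
  have h := hasDerivAt_integral_of_dominated_loc_of_deriv_le
    (μ := volume.restrict (Ioi (0 : ℝ))) (s := Ioi (y / 2)) (x₀ := y)
    (F := fun (y : ℝ) (t : ℝ) => (t : ℂ) ^ (ν - 1) * (Real.exp (-t - y / t) : ℂ))
    (F' := fun (y : ℝ) (t : ℝ) => -((t : ℂ) ^ (ν - 1 - 1) * (Real.exp (-t - y / t) : ℂ)))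
    (bound := fun t => ‖(t : ℂ) ^ (ν - 1 - 1) * (Real.exp (-t - (y / 2) / t) : ℂ)‖)
    (Ioi_mem_nhds (by linarith))
    (by
      filter_upwards [Ioi_mem_nhds hy] with z hz
      exact (macdonald_integrableOn hz ν).aestronglyMeasurable)
    (macdonald_integrableOn hy ν)
    (macdonald_integrableOn hy (ν - 1)).neg.aestronglyMeasurable
    (by
      filter_upwards [ae_restrict_mem measurableSet_Ioi] with t (ht : 0 < t) z (hz : y / 2 < z)
      rw [norm_neg, norm_mul, norm_mul, Complex.norm_real, Complex.norm_real, Real.norm_eq_abs,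
        Real.abs_exp, Real.norm_eq_abs, Real.abs_exp]
      gcongr)
    (macdonald_integrableOn (half_pos hy) (ν - 1)).norm
    (by
      filter_upwards [ae_restrict_mem measurableSet_Ioi] with t (ht : 0 < t) z hz
      have h1 : HasDerivAt (fun z : ℝ => Real.exp (-t - z / t))
          (Real.exp (-t - z / t) * (-(1 / t))) z :=
        (((hasDerivAt_id z).div_const t).const_sub (-t)).exp
      have h2 := (h1.ofReal_comp).const_mul ((t : ℂ) ^ (ν - 1))
      convert! h2 using 1
      have ht' : (t : ℂ) ≠ 0 := by exact_mod_cast ht.ne'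
      rw [Complex.cpow_sub _ 1 ht', Complex.cpow_one]
      push_cast
      field_simp)
  have h2 := h.2
  rw [integral_neg, ← macdonaldIntegral_eq] at h2
  have h3 : macdonaldIntegral ν = fun y : ℝ => ∫ t in Ioi (0 : ℝ),
      (t : ℂ) ^ (ν - 1) * (Real.exp (-t - y / t) : ℂ) := funext (macdonaldIntegral_eq ν)
  rw [h3]
  exact h2

/-- The derivative of `t^ν e^(-t - y/t)` integrates to zero over `(0, ∞)`. The boundary term at `0`
is `O(t^(Re ν + M))`, hence the choice `M > -Re ν`. -/
theorem macdonaldIntegral_add_one {y : ℝ} (hy : 0 < y) (ν : ℂ) :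
    macdonaldIntegral (ν + 1) y =
      ν * macdonaldIntegral ν y + y * macdonaldIntegral (ν - 1) y := by
  obtain ⟨M, hM⟩ := exists_nat_gt (-ν.re)
  have hy' : (y : ℂ) ≠ 0 := by exact_mod_cast hy.ne'
  have i0 := macdonald_integrableOn hy ν
  have i1 := macdonald_integrableOn hy (ν + 1)
  have i2 := macdonald_integrableOn hy (ν - 1)
  have e : ∀ t ∈ Ioi (0 : ℝ), ν * (t : ℂ) ^ (ν - 1) * (Real.exp (-t - y / t) : ℂ) +
      (t : ℂ) ^ ν * ((Real.exp (-t - y / t) * (-1 - -(y / t ^ 2)) : ℝ) : ℂ) =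
      ν * ((t : ℂ) ^ (ν - 1) * (Real.exp (-t - y / t) : ℂ)) -
        ((t : ℂ) ^ (ν + 1 - 1) * (Real.exp (-t - y / t) : ℂ)) +
        y * ((t : ℂ) ^ (ν - 1 - 1) * (Real.exp (-t - y / t) : ℂ)) := by
    intro t (ht : 0 < t)
    have ht' : (t : ℂ) ≠ 0 := by exact_mod_cast ht.ne'
    rw [add_sub_cancel_right, Complex.cpow_sub (ν - 1) 1 ht', Complex.cpow_sub ν 1 ht',
      Complex.cpow_one]
    push_cast
    field_simp
    ring
  have hn : ∀ t : ℝ, 0 < t → ‖(t : ℂ) ^ ν * (Real.exp (-t - y / t) : ℂ)‖ =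
      t ^ ν.re * Real.exp (-t - y / t) := by
    intro t ht
    rw [norm_mul, Complex.norm_cpow_eq_rpow_re_of_pos ht, Complex.norm_real, Real.norm_eq_abs,
      Real.abs_exp]
  have key := integral_Ioi_deriv_mul_eq_sub (a := (0 : ℝ)) (a' := (0 : ℂ)) (b' := (0 : ℂ))
    (u := fun t : ℝ => (t : ℂ) ^ ν) (u' := fun t : ℝ => ν * (t : ℂ) ^ (ν - 1))
    (v := fun t : ℝ => (Real.exp (-t - y / t) : ℂ))
    (v' := fun t : ℝ => ((Real.exp (-t - y / t) * (-1 - -(y / t ^ 2)) : ℝ) : ℂ))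
    (by
      intro t (ht : 0 < t)
      have := ((hasDerivAt_id (t : ℂ)).cpow_const (c := ν) (by simp [ht])).comp_ofReal
      simpa using this)
    (by
      intro t (ht : 0 < t)
      apply HasDerivAt.ofReal_comp
      apply HasDerivAt.exp
      have := (hasDerivAt_id t).neg.sub ((hasDerivAt_inv ht.ne').const_mul y)
      convert! this using 1
      field_simp)
    (by
      refine IntegrableOn.congr_fun (((i0.const_mul ν).sub i1).add (i2.const_mul (y : ℂ)))
        (fun t ht => ?_) measurableSet_Ioi
      exact (e t ht).symm)
    (by
      rw [tendsto_zero_iff_norm_tendsto_zero]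
      have hlim : Tendsto (fun t : ℝ => M.factorial / y ^ M * t ^ (ν.re + M)) (𝓝[>] 0) (𝓝 0) := by
        have := ((Real.continuous_rpow_const (q := ν.re + M) (by linarith)).tendsto 0).const_mul
          (M.factorial / y ^ M : ℝ)
        rw [Real.zero_rpow (by linarith), mul_zero] at this
        exact this.mono_left nhdsWithin_le_nhds
      refine squeeze_zero' (Eventually.of_forall fun _ => norm_nonneg _) ?_ hlim
      filter_upwards [self_mem_nhdsWithin] with t (ht : 0 < t)
      rw [Pi.mul_apply, hn t ht, Real.rpow_add ht, Real.rpow_natCast]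
      have h1 : Real.exp (-t) ≤ 1 := Real.exp_le_one_iff.mpr (by linarith)
      calc t ^ ν.re * Real.exp (-t - y / t)
          ≤ t ^ ν.re * (M.factorial / y ^ M * (t ^ M * 1)) := by
            gcongr
            refine (exp_neg_sub_div_le hy ht M).trans ?_
            gcongr
        _ = _ := by ring)
    (by
      rw [tendsto_zero_iff_norm_tendsto_zero]
      refine squeeze_zero' (Eventually.of_forall fun _ => norm_nonneg _) ?_
        (tendsto_rpow_mul_exp_neg_mul_atTop_nhds_zero ν.re 1 one_pos)
      filter_upwards [eventually_gt_atTop 0] with t ht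
      rw [Pi.mul_apply, hn t ht]
      gcongr
      have := div_pos hy ht
      linarith)
  rw [setIntegral_congr_fun measurableSet_Ioi e, integral_add, integral_sub, integral_const_mul,
    integral_const_mul, ← macdonaldIntegral_eq, ← macdonaldIntegral_eq, ← macdonaldIntegral_eq]
    at key
  · linear_combination -key
  · exact i0.const_mul ν
  · exact i1
  · exact (i0.const_mul ν).sub i1
  · exact i2.const_mul _

theorem integral_norm_macdonald_kernel_le {y : ℝ} (hy : 0 < y) (ν : ℂ) {M : ℕ} (hM : 0 < ν.re + M) :
    ∫ t in Ioi (0 : ℝ), ‖(t : ℂ) ^ (ν - 1) * (Real.exp (-t - y / t) : ℂ)‖ ≤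
      M.factorial * Real.Gamma (ν.re + M) / y ^ M := by
  rw [Real.Gamma_eq_integral hM]
  have : M.factorial * (∫ t in Ioi (0 : ℝ), Real.exp (-t) * t ^ (ν.re + M - 1)) / y ^ M =
      ∫ t in Ioi (0 : ℝ), M.factorial / y ^ M * (Real.exp (-t) * t ^ (ν.re + M - 1)) := by
    rw [integral_const_mul]; ring
  rw [this]
  apply setIntegral_mono_on (macdonald_integrableOn hy ν).norm
    ((Real.GammaIntegral_convergent hM).const_mul _) measurableSet_Ioi
  intro t (ht : 0 < t)
  rw [norm_mul, norm_cpow_sub_one ht, Complex.norm_real, Real.norm_eq_abs, Real.abs_exp,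
    show ν.re + M - 1 = (ν.re - 1) + M by ring, Real.rpow_add ht, Real.rpow_natCast]
  calc _ ≤ t ^ (ν.re - 1) * (M.factorial / y ^ M * (t ^ M * Real.exp (-t))) := by
        gcongr
        exact exp_neg_sub_div_le hy ht M
    _ = _ := by ring

end Macdonald

/-! ### Bessel series, Wronskians, and the integral representation of `K_ν`. -/

/-- The regularized series `∑ y^n / (n! Γ(n+1+ν))`, so that `I_ν(z) = (z/2)^ν` times its value
at `z²/4`. -/
noncomputable def besselSeries (ν : ℂ) (y : ℝ) : ℂ :=
  ∑' n : ℕ, (y : ℂ) ^ n / ((n.factorial : ℂ) * Complex.Gamma (ν + n + 1))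

section BesselSeries

/-- With the value `0` for `1/Γ` at the poles, the functional equation has no exceptional points, so
the series identities below hold for every order, integers included. -/
theorem Complex.inv_Gamma_eq_mul (s : ℂ) :
    (Complex.Gamma s)⁻¹ = s * (Complex.Gamma (s + 1))⁻¹ := by
  rcases eq_or_ne s 0 with rfl | hs
  · simp
  · rw [Complex.Gamma_add_one s hs, mul_inv]
    field_simp

/-- Once `Re ν + n` is large enough, each step divides by a number of modulus at least `1`, so the
norms stop growing; finitely many terms remain. -/
theorem exists_norm_inv_Gamma_le (ν : ℂ) :
    ∃ C : ℝ, 0 ≤ C ∧ ∀ n : ℕ, ‖(Complex.Gamma (ν + n + 1))⁻¹‖ ≤ C := by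
  obtain ⟨N, hN⟩ := exists_nat_gt (1 - ν.re)
  have hmono : ∀ n : ℕ, ‖(Complex.Gamma (ν + (N + n : ℕ) + 1))⁻¹‖ ≤
      ‖(Complex.Gamma (ν + N + 1))⁻¹‖ := by
    intro n
    induction n with
    | zero => simp
    | succ n ih =>
      refine le_trans ?_ ih
      rw [Complex.inv_Gamma_eq_mul (ν + (N + n : ℕ) + 1), norm_mul]
      have h1 : (1 : ℝ) ≤ ‖ν + (N + n : ℕ) + 1‖ := by
        refine le_trans ?_ (Complex.re_le_norm _)
        have : (0 : ℝ) ≤ n := n.cast_nonneg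
        simp
        linarith
      have h2 : ν + (N + (n + 1) : ℕ) + 1 = ν + (N + n : ℕ) + 1 + 1 := by push_cast; ring
      rw [h2]
      exact le_mul_of_one_le_left (norm_nonneg _) h1
  refine ⟨∑ n ∈ Finset.range (N + 1), ‖(Complex.Gamma (ν + n + 1))⁻¹‖,
    Finset.sum_nonneg fun _ _ => norm_nonneg _, fun n => ?_⟩
  rcases le_total n N with h | h
  · exact Finset.single_le_sum (f := fun n : ℕ => ‖(Complex.Gamma (ν + n + 1))⁻¹‖)
      (fun _ _ => norm_nonneg _) (Finset.mem_range.mpr (by omega))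
  · obtain ⟨m, rfl⟩ := Nat.exists_eq_add_of_le h
    exact (hmono m).trans (Finset.single_le_sum
      (f := fun n : ℕ => ‖(Complex.Gamma (ν + n + 1))⁻¹‖)
      (fun _ _ => norm_nonneg _) (Finset.mem_range.mpr (by omega)))

theorem summable_besselSeries (ν : ℂ) (y : ℝ) :
    Summable fun n : ℕ => (y : ℂ) ^ n / ((n.factorial : ℂ) * Complex.Gamma (ν + n + 1)) := by
  obtain ⟨C, hC0, hC⟩ := exists_norm_inv_Gamma_le ν
  refine Summable.of_norm_bounded ((Real.summable_pow_div_factorial |y|).mul_right C) fun n => ?_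
  rw [div_mul_eq_div_div, div_eq_mul_inv _ (Complex.Gamma _), norm_mul, norm_div, norm_pow,
    Complex.norm_real, Complex.norm_natCast, Real.norm_eq_abs]
  gcongr
  exact hC n

theorem hasDerivAt_besselSeries (ν : ℂ) (y : ℝ) :
    HasDerivAt (besselSeries ν) (besselSeries (ν + 1) y) y := by
  obtain ⟨C, hC0, hC⟩ := exists_norm_inv_Gamma_le ν
  set R : ℝ := |y| + 1
  have hR : 0 ≤ R := by positivity
  have hu : Summable fun n : ℕ => (n : ℝ) * R ^ (n - 1) / n.factorial * C := by
    apply Summable.mul_right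
    rw [← summable_nat_add_iff 1]
    refine (Real.summable_pow_div_factorial R).congr fun n => ?_
    rw [Nat.factorial_succ, Nat.add_sub_cancel]
    push_cast
    field_simp
  have key := hasDerivAt_tsum_of_isPreconnected (𝕜 := ℝ) (F := ℂ) (t := Metric.ball (0 : ℝ) R)
    (g := fun (n : ℕ) (z : ℝ) => (z : ℂ) ^ n / ((n.factorial : ℂ) * Complex.Gamma (ν + n + 1)))
    (g' := fun (n : ℕ) (z : ℝ) =>
      (n : ℂ) * (z : ℂ) ^ (n - 1) / ((n.factorial : ℂ) * Complex.Gamma (ν + n + 1)))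
    (y₀ := 0) (y := y) hu Metric.isOpen_ball (convex_ball _ _).isPreconnected
    (fun n z _ => by
      have := ((hasDerivAt_pow n (z : ℂ)).comp_ofReal).div_const
        ((n.factorial : ℂ) * Complex.Gamma (ν + n + 1))
      exact this)
    (fun n z hz => by
      rw [mem_ball_zero_iff, Real.norm_eq_abs] at hz
      rw [div_mul_eq_div_div, div_eq_mul_inv _ (Complex.Gamma _), norm_mul, norm_div, norm_mul,
        norm_pow, Complex.norm_real, Complex.norm_natCast, Complex.norm_natCast, Real.norm_eq_abs]
      gcongr
      exact hC n)
    (by simp [R]; positivity) (summable_besselSeries ν 0)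
    (by simp [R])
  have h0 : ∀ z : ℝ, besselSeries ν z = ∑' n : ℕ,
      (z : ℂ) ^ n / ((n.factorial : ℂ) * Complex.Gamma (ν + n + 1)) := fun z => rfl
  have h1 : besselSeries (ν + 1) y = ∑' n : ℕ,
      (n : ℂ) * (y : ℂ) ^ (n - 1) / ((n.factorial : ℂ) * Complex.Gamma (ν + n + 1)) := by
    rw [besselSeries]
    have hterm : ∀ n : ℕ, ((n + 1 : ℕ) : ℂ) * (y : ℂ) ^ (n + 1 - 1) /
        (((n + 1).factorial : ℂ) * Complex.Gamma (ν + (n + 1 : ℕ) + 1)) =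
        (y : ℂ) ^ n / ((n.factorial : ℂ) * Complex.Gamma (ν + 1 + n + 1)) := by
      intro n
      rw [Nat.factorial_succ, Nat.add_sub_cancel,
        show ν + (n + 1 : ℕ) + 1 = ν + 1 + n + 1 by push_cast; ring]
      push_cast
      have : (n : ℂ) + 1 ≠ 0 := by exact_mod_cast n.succ_ne_zero
      rw [mul_assoc, mul_div_mul_left _ _ this]
    have hs : Summable fun n : ℕ => (n : ℂ) * (y : ℂ) ^ (n - 1) /
        ((n.factorial : ℂ) * Complex.Gamma (ν + n + 1)) := by
      rw [← summable_nat_add_iff 1]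
      exact (summable_besselSeries (ν + 1) y).congr fun n => (hterm n).symm
    rw [hs.tsum_eq_zero_add]
    simp only [Nat.cast_zero, zero_mul, zero_div, zero_add]
    exact tsum_congr fun n => (hterm n).symm
  rw [h1]
  exact key

theorem besselSeries_zero (ν : ℂ) : besselSeries ν 0 = (Complex.Gamma (ν + 1))⁻¹ := by
  rw [besselSeries, tsum_eq_single 0]
  · simp
  · intro n hn
    simp [hn]

theorem besselSeries_sub_one (ν : ℂ) (y : ℝ) :
    besselSeries (ν - 1) y = ν * besselSeries ν y + y * besselSeries (ν + 1) y := by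
  have h1 : y * besselSeries (ν + 1) y = ∑' n : ℕ,
      (n : ℂ) * (y : ℂ) ^ n / ((n.factorial : ℂ) * Complex.Gamma (ν + n + 1)) ∧
      Summable fun n : ℕ =>
        (n : ℂ) * (y : ℂ) ^ n / ((n.factorial : ℂ) * Complex.Gamma (ν + n + 1)) := by
    have hterm : ∀ n : ℕ, ((n + 1 : ℕ) : ℂ) * (y : ℂ) ^ (n + 1) /
        (((n + 1).factorial : ℂ) * Complex.Gamma (ν + (n + 1 : ℕ) + 1)) =
        y * ((y : ℂ) ^ n / ((n.factorial : ℂ) * Complex.Gamma (ν + 1 + n + 1))) := by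
      intro n
      rw [Nat.factorial_succ, show ν + (n + 1 : ℕ) + 1 = ν + 1 + n + 1 by push_cast; ring]
      push_cast
      have : (n : ℂ) + 1 ≠ 0 := by exact_mod_cast n.succ_ne_zero
      rw [mul_assoc ((n : ℂ) + 1), mul_div_mul_left _ _ this, pow_succ]
      ring
    have hs : Summable fun n : ℕ => (n : ℂ) * (y : ℂ) ^ n /
        ((n.factorial : ℂ) * Complex.Gamma (ν + n + 1)) := by
      rw [← summable_nat_add_iff 1]
      exact ((summable_besselSeries (ν + 1) y).mul_left (y : ℂ)).congr fun n => (hterm n).symm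
    refine ⟨?_, hs⟩
    rw [hs.tsum_eq_zero_add, besselSeries, ← tsum_mul_left]
    simp only [Nat.cast_zero, zero_mul, zero_div, zero_add]
    exact tsum_congr fun n => (hterm n).symm
  rw [h1.1, besselSeries, besselSeries, ← tsum_mul_left,
    ← Summable.tsum_add ((summable_besselSeries ν y).mul_left ν) h1.2]
  refine tsum_congr fun n => ?_
  have h2 := Complex.inv_Gamma_eq_mul (ν + n)
  rw [div_mul_eq_div_div, div_mul_eq_div_div, div_mul_eq_div_div,
    div_eq_mul_inv _ (Complex.Gamma _), div_eq_mul_inv _ (Complex.Gamma _),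
    div_eq_mul_inv _ (Complex.Gamma _), show ν - 1 + n + 1 = ν + n by ring, h2]
  ring

/-- The contiguity relations make the derivative in `y` vanish. The constant is read off at `y = 0`,
where it is Euler's reflection formula. -/
theorem besselSeries_reflection (ν : ℂ) (y : ℝ) :
    besselSeries (ν - 1) y * besselSeries (-ν) y - y * besselSeries ν y * besselSeries (1 - ν) y =
      Complex.sin (Real.pi * ν) / Real.pi := by
  have hd : ∀ z : ℝ, HasDerivAt (fun z : ℝ => besselSeries (ν - 1) z * besselSeries (-ν) z -
      z * besselSeries ν z * besselSeries (1 - ν) z) 0 z := by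
    intro z
    have h1 := hasDerivAt_besselSeries (ν - 1) z
    have h2 := hasDerivAt_besselSeries (-ν) z
    have h3 := hasDerivAt_besselSeries ν z
    have h4 := hasDerivAt_besselSeries (1 - ν) z
    have h5 := (hasDerivAt_id (z : ℂ)).comp_ofReal
    have h := (h1.mul h2).sub ((h5.mul h3).mul h4)
    have e1 := besselSeries_sub_one ν z
    have e2 := besselSeries_sub_one (1 - ν) z
    rw [show 1 - ν - 1 = -ν by ring] at e2
    convert! h using 1
    rw [show ν - 1 + 1 = ν by ring, show -ν + 1 = 1 - ν by ring]
    simp only [id, Pi.mul_apply]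
    rw [e1, e2]
    ring
  have hc := is_const_of_deriv_eq_zero (fun z => (hd z).differentiableAt)
    (fun z => (hd z).deriv) y 0
  rw [hc, besselSeries_zero, besselSeries_zero, Complex.ofReal_zero, zero_mul, zero_mul, sub_zero,
    sub_add_cancel, show -ν + 1 = 1 - ν by ring, ← mul_inv, Complex.Gamma_mul_Gamma_one_sub,
    inv_div]

theorem tendsto_besselSeries_zero (ν : ℂ) :
    Tendsto (besselSeries ν) (𝓝[>] 0) (𝓝 (Complex.Gamma (ν + 1))⁻¹) := by
  rw [← besselSeries_zero]
  exact (hasDerivAt_besselSeries ν 0).continuousAt.mono_left nhdsWithin_le_nhds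

/-- By the two recurrences the expression has zero derivative on `(0, ∞)`, and its limit at `0` is
`Γ(ν+1)/Γ(ν+1)`. -/
theorem macdonald_wronskian_of_re {ν : ℂ} (hν : -1 < ν.re) {y : ℝ} (hy : 0 < y) :
    macdonaldIntegral (ν + 1) y * besselSeries ν y +
      y * macdonaldIntegral ν y * besselSeries (ν + 1) y = 1 := by
  set W : ℝ → ℂ := fun y => macdonaldIntegral (ν + 1) y * besselSeries ν y +
      y * macdonaldIntegral ν y * besselSeries (ν + 1) y with hW
  have hd : ∀ z ∈ Set.Ioi (0 : ℝ), HasDerivAt W 0 z := by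
    intro z hz
    have h1 := hasDerivAt_macdonaldIntegral hz (ν + 1)
    have h2 := hasDerivAt_macdonaldIntegral hz ν
    have h3 := hasDerivAt_besselSeries ν z
    have h4 := hasDerivAt_besselSeries (ν + 1) z
    have h5 := (hasDerivAt_id (z : ℂ)).comp_ofReal
    have h := (h1.mul h3).add ((h5.mul h2).mul h4)
    have e1 := besselSeries_sub_one (ν + 1) z
    have e2 := macdonaldIntegral_add_one hz ν
    rw [add_sub_cancel_right] at e1
    convert! h using 1
    rw [add_sub_cancel_right]
    simp only [id, Pi.mul_apply]
    rw [e1, e2]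
    ring
  have hlim : Tendsto W (𝓝[>] 0) (𝓝 1) := by
    have t1 := tendsto_macdonaldIntegral_zero (ν := ν + 1) (by simp; linarith)
    have t2 := tendsto_macdonaldIntegral_zero (ν := ν + 1 + 1) (by simp; linarith)
    -- `Re ν` may be nonpositive here, so the limit is taken from the recurrence: it equals `Γ(ν+2)
    -- - (ν+1)Γ(ν+1) = 0`.
    have t3 : Tendsto (fun y : ℝ => y * macdonaldIntegral ν y) (𝓝[>] 0) (𝓝 0) := by
      have h := t2.sub (t1.const_mul (ν + 1))
      have hν1 : ν + 1 ≠ 0 := by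
        intro h0
        have := congrArg Complex.re h0
        simp at this
        linarith
      rw [Complex.Gamma_add_one _ hν1, sub_self] at h
      refine h.congr' ?_
      filter_upwards [self_mem_nhdsWithin] with z hz
      rw [macdonaldIntegral_add_one hz (ν + 1), add_sub_cancel_right]
      ring
    have h := (t1.mul (tendsto_besselSeries_zero ν)).add
      (t3.mul (tendsto_besselSeries_zero (ν + 1)))
    rwa [zero_mul, add_zero, mul_inv_cancel₀] at h
    apply Complex.Gamma_ne_zero_of_re_pos
    simp
    linarith
  have hconst : ∀ z ∈ Set.Ioi (0 : ℝ), W z = W y := by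
    intro z hz
    exact (convex_Ioi (0 : ℝ)).is_const_of_fderivWithin_eq_zero (𝕜 := ℝ)
      (fun w hw => (hd w hw).differentiableAt.differentiableWithinAt)
      (fun w hw => by
        rw [fderivWithin_of_isOpen isOpen_Ioi hw]
        ext
        simp [(hd w hw).deriv]) hz hy
  have hlim2 : Tendsto W (𝓝[>] 0) (𝓝 (W y)) := by
    refine tendsto_const_nhds.congr' ?_
    filter_upwards [self_mem_nhdsWithin] with z hz using (hconst z hz).symm
  exact tendsto_nhds_unique hlim2 hlim

/-- The recurrences turn the identity at `μ + 1` into the identity at `μ`, so it spreads to the left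
one unit strip at a time. -/
theorem macdonald_wronskian (ν : ℂ) {y : ℝ} (hy : 0 < y) :
    macdonaldIntegral (ν + 1) y * besselSeries ν y +
      y * macdonaldIntegral ν y * besselSeries (ν + 1) y = 1 := by
  have h : ∀ n : ℕ, ∀ μ : ℂ, -1 - (n : ℝ) < μ.re → macdonaldIntegral (μ + 1) y * besselSeries μ y +
      y * macdonaldIntegral μ y * besselSeries (μ + 1) y = 1 := by
    intro n
    induction n with
    | zero => intro μ hμ; exact macdonald_wronskian_of_re (by simpa using hμ) hy
    | succ n ih =>
      intro μ hμ
      have h1 := ih (μ + 1) (by simp at hμ ⊢; linarith)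
      have e1 := besselSeries_sub_one (μ + 1) y
      have e2 := macdonaldIntegral_add_one hy (μ + 1)
      rw [add_sub_cancel_right] at e1 e2
      rw [e2] at h1
      rw [e1]
      linear_combination h1
  obtain ⟨n, hn⟩ := exists_nat_gt (-ν.re)
  exact h n ν (by linarith)

/-- The Wronskian identities at `ν - 1` and `-ν`, with the symmetry `ν ↦ -ν`, are two linear
equations for the integrals of orders `ν` and `1 - ν`. Eliminating the latter leaves the reflection
expression as coefficient. -/
theorem macdonaldIntegral_mul_sin (ν : ℂ) {y : ℝ} (hy : 0 < y) :
    macdonaldIntegral ν y * (Complex.sin (Real.pi * ν) / Real.pi) =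
      besselSeries (-ν) y - (y : ℂ) ^ ν * besselSeries ν y := by
  have hy' : (y : ℂ) ≠ 0 := by exact_mod_cast hy.ne'
  have w1 := macdonald_wronskian (ν - 1) hy
  have w2 := macdonald_wronskian (-ν) hy
  rw [sub_add_cancel, macdonaldIntegral_neg hy (ν - 1), show -(ν - 1) = 1 - ν by ring] at w1
  rw [show -ν + 1 = 1 - ν by ring] at w2
  have e := macdonaldIntegral_neg hy ν
  have ep : (y : ℂ) * (y : ℂ) ^ (ν - 1) = (y : ℂ) ^ ν := by
    rw [Complex.cpow_sub _ _ hy', Complex.cpow_one]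
    field_simp
  rw [← besselSeries_reflection ν y]
  linear_combination (besselSeries (-ν) y) * w1 - (y : ℂ) ^ ν * besselSeries ν y * w2 -
    (y * besselSeries ν y * besselSeries (1 - ν) y) * e -
    (macdonaldIntegral (1 - ν) y * besselSeries ν y * besselSeries (-ν) y) * ep

theorem besselI_eq {z : ℝ} (hz : 0 < z) (ν : ℂ) :
    besselI ν z = ((z / 2 : ℝ) : ℂ) ^ ν * besselSeries ν (z ^ 2 / 4) := by
  have hz' : ((z / 2 : ℝ) : ℂ) ≠ 0 := by exact_mod_cast (half_pos hz).ne'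
  rw [besselI, besselSeries, ← tsum_mul_left]
  refine tsum_congr fun n => ?_
  rw [show ((z : ℂ) / 2) = ((z / 2 : ℝ) : ℂ) by push_cast; ring, Complex.cpow_add _ _ hz',
    show (2 * (n : ℂ)) = ((2 * n : ℕ) : ℂ) by push_cast; ring, Complex.cpow_natCast, pow_mul,
    show (((z / 2 : ℝ) : ℂ)) ^ 2 = ((z ^ 2 / 4 : ℝ) : ℂ) by push_cast; ring]
  ring

theorem besselKQuot_eq {z : ℝ} (hz : 0 < z) {ν : ℂ} (hν : ¬ ∃ m : ℤ, ν = m) :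
    besselKQuot ν z = 1 / 2 * ((z / 2 : ℝ) : ℂ) ^ (-ν) * macdonaldIntegral ν (z ^ 2 / 4) := by
  have hz' : ((z / 2 : ℝ) : ℂ) ≠ 0 := by exact_mod_cast (half_pos hz).ne'
  have hpi : (Real.pi : ℂ) ≠ 0 := by exact_mod_cast Real.pi_ne_zero
  have hsin : Complex.sin (Real.pi * ν) ≠ 0 := by
    rw [Complex.sin_ne_zero_iff]
    intro m h
    exact hν ⟨m, mul_left_cancel₀ hpi (by rw [h]; ring)⟩
  have h := macdonaldIntegral_mul_sin ν (y := z ^ 2 / 4) (by positivity)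
  have hp : ((z ^ 2 / 4 : ℝ) : ℂ) ^ ν * ((z / 2 : ℝ) : ℂ) ^ (-ν) = ((z / 2 : ℝ) : ℂ) ^ ν := by
    rw [show z ^ 2 / 4 = z / 2 * (z / 2) by ring, Complex.ofReal_mul,
      Complex.mul_cpow_ofReal_nonneg (half_pos hz).le (half_pos hz).le, mul_assoc,
      ← Complex.cpow_add _ _ hz', add_neg_cancel, Complex.cpow_zero, mul_one]
  rw [besselKQuot, besselI_eq hz, besselI_eq hz]
  field_simp at h ⊢
  linear_combination -(((z / 2 : ℝ) : ℂ) ^ (-ν)) * h + Real.pi * besselSeries ν (z ^ 2 / 4) * hp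

/-- `K_ν(z) = ½ (z/2)^(-ν) ∫₀^∞ t^(ν-1) exp(-t - z²/(4t)) dt` for `z > 0` and every order. -/
theorem besselK_eq {z : ℝ} (hz : 0 < z) (ν : ℂ) :
    besselK ν z = 1 / 2 * ((z / 2 : ℝ) : ℂ) ^ (-ν) * macdonaldIntegral ν (z ^ 2 / 4) := by
  have hz' : ((z / 2 : ℝ) : ℂ) ≠ 0 := by exact_mod_cast (half_pos hz).ne'
  rw [besselK]
  split_ifs with h
  · apply Tendsto.limUnder_eq
    obtain ⟨m, rfl⟩ := h
    -- The integral is differentiable in the order everywhere, so the removable singularity at an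
    -- integer is filled by its value there.
    have hc : Continuous fun μ : ℂ =>
        1 / 2 * ((z / 2 : ℝ) : ℂ) ^ (-μ) * macdonaldIntegral μ (z ^ 2 / 4) := by
      refine (continuous_const.mul ?_).mul
        (differentiable_macdonaldIntegral (by positivity)).continuous
      exact continuous_neg.const_cpow (Or.inl hz')
    refine ((hc.tendsto (m : ℂ)).mono_left nhdsWithin_le_nhds).congr' ?_
    -- The unit ball about `m` contains no other integer, so the formula for non-integral order
    -- applies on the punctured ball.
    have hball : Metric.ball (m : ℂ) 1 ∈ 𝓝 (m : ℂ) := Metric.ball_mem_nhds _ one_pos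
    filter_upwards [mem_nhdsWithin_of_mem_nhds hball, self_mem_nhdsWithin] with μ hμ hne
    refine (besselKQuot_eq hz ?_).symm
    rintro ⟨l, rfl⟩
    rw [Metric.mem_ball, dist_eq_norm, ← Int.cast_sub, Complex.norm_intCast] at hμ
    have : |l - m| < 1 := by exact_mod_cast hμ
    rw [Int.abs_lt_one_iff, sub_eq_zero] at this
    exact hne (by simp [this])
  · exact besselKQuot_eq hz h

end BesselSeries

/-! ### Laplace integrals of powers and the twisted Lipschitz formula. -/

section Lipschitz

open MeasureTheory Set

theorem integrableOn_pow_mul_cexp_neg (k : ℕ) {r : ℂ} (hr : 0 < r.re) :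
    IntegrableOn (fun x : ℝ => (x : ℂ) ^ k * Complex.exp (-r * x)) (Ioi 0) := by
  have h : IntegrableOn (fun x : ℝ => x ^ (k : ℝ) * Real.exp (-r.re * x)) (Ioi 0) := by
    have := integrableOn_rpow_mul_exp_neg_mul_rpow (p := 1) (s := k) (b := r.re)
      (by have : (0 : ℝ) ≤ k := k.cast_nonneg
          linarith) one_pos hr
    simpa using this
  refine Integrable.mono' h (by fun_prop) ?_
  filter_upwards [ae_restrict_mem measurableSet_Ioi] with x (hx : 0 < x)
  rw [norm_mul, norm_pow, Complex.norm_exp, Complex.norm_real, Real.norm_eq_abs, abs_of_pos hx,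
    Real.rpow_natCast]
  simp

theorem tendsto_pow_mul_cexp_neg (k : ℕ) {r : ℂ} (hr : 0 < r.re) :
    Tendsto (fun x : ℝ => (x : ℂ) ^ k * Complex.exp (-r * x)) atTop (𝓝 0) := by
  rw [tendsto_zero_iff_norm_tendsto_zero]
  refine (tendsto_rpow_mul_exp_neg_mul_atTop_nhds_zero k r.re hr).congr' ?_
  filter_upwards [eventually_gt_atTop 0] with x hx
  rw [norm_mul, norm_pow, Complex.norm_exp, Complex.norm_real, Real.norm_eq_abs, abs_of_pos hx,
    Real.rpow_natCast]
  simp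

theorem integral_pow_mul_cexp_neg (k : ℕ) {r : ℂ} (hr : 0 < r.re) :
    ∫ x in Ioi (0 : ℝ), (x : ℂ) ^ k * Complex.exp (-r * x) = k.factorial / r ^ (k + 1) := by
  have hr0 : r ≠ 0 := by
    rintro rfl
    simp at hr
  induction k with
  | zero =>
    simp only [pow_zero, one_mul]
    rw [integral_exp_mul_complex_Ioi (by simpa using hr)]
    simp
  | succ k ih =>
    have hexp : ∀ x : ℝ, HasDerivAt (fun x : ℝ => Complex.exp (-r * x))
        (Complex.exp (-r * x) * -r) x := by
      intro x
      have := (((hasDerivAt_id (x : ℂ)).const_mul (-r)).cexp).comp_ofReal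
      simpa using this
    have hpow : ∀ x : ℝ, HasDerivAt (fun x : ℝ => (x : ℂ) ^ (k + 1))
        ((k + 1 : ℕ) * (x : ℂ) ^ k) x := by
      intro x
      have := (hasDerivAt_pow (k + 1) (x : ℂ)).comp_ofReal
      simpa using this
    have i1 := integrableOn_pow_mul_cexp_neg (k + 1) hr
    have i0 := integrableOn_pow_mul_cexp_neg k hr
    have key := integral_Ioi_of_hasDerivAt_of_tendsto' (a := 0) (m := (0 : ℂ))
      (f := fun x : ℝ => (x : ℂ) ^ (k + 1) * Complex.exp (-r * x))
      (f' := fun x : ℝ => ((k + 1 : ℕ) : ℂ) * ((x : ℂ) ^ k * Complex.exp (-r * x)) -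
        r * ((x : ℂ) ^ (k + 1) * Complex.exp (-r * x)))
      (fun x _ => by
        convert! (hpow x).mul (hexp x) using 1
        ring)
      ((i0.const_mul _).sub (i1.const_mul _)) (tendsto_pow_mul_cexp_neg (k + 1) hr)
    rw [integral_sub (i0.const_mul _) (i1.const_mul _), integral_const_mul, integral_const_mul,
      ih] at key
    simp only [Complex.ofReal_zero, zero_pow (Nat.succ_ne_zero k), zero_mul, sub_zero] at key
    have h2 := (sub_eq_zero.mp key).symm
    rw [Nat.factorial_succ]
    field_simp at h2 ⊢
    push_cast at h2 ⊢
    linear_combination h2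

theorem integral_Ioi_pow_mul_exp_neg (k : ℕ) {b : ℝ} (hb : 0 < b) :
    ∫ x in Ioi (0 : ℝ), x ^ k * Real.exp (-b * x) = k.factorial / b ^ (k + 1) := by
  have h := integral_pow_mul_cexp_neg k (r := (b : ℂ)) (by simpa using hb)
  have e : ∀ x : ℝ, (x : ℂ) ^ k * Complex.exp (-(b : ℂ) * x) =
      ((x ^ k * Real.exp (-b * x) : ℝ) : ℂ) := by
    intro x
    push_cast
    rfl
  simp only [e] at h
  rw [integral_complex_ofReal] at h
  exact_mod_cast h

/-- `∑_{n ≥ 0} (n+ψ)^k e^{-2πs(n+ψ)}`. -/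
noncomputable def shiftedExpSum (k : ℕ) (s ψ : ℝ) : ℝ :=
  ∑' n : ℕ, ((n : ℝ) + ψ) ^ k * Real.exp (-(2 * Real.pi * s * (n + ψ)))

theorem pow_mul_exp_neg_le {b : ℝ} (hb : 0 < b) {x : ℝ} (hx : 0 < x) (k M : ℕ) :
    x ^ k * Real.exp (-(b * x)) ≤ (k + M).factorial / b ^ (k + M) * (x ^ M)⁻¹ := by
  have h := Real.exp_neg_le_factorial_div_pow (mul_pos hb hx) (k + M)
  calc _ ≤ x ^ k * ((k + M).factorial / (b * x) ^ (k + M)) := by gcongr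
    _ = _ := by rw [mul_pow, pow_add x]; field_simp

theorem summable_shifted_inv_sq {ψ : ℝ} (hψ : 0 < ψ) :
    Summable fun n : ℕ => (((n : ℝ) + ψ) ^ 2)⁻¹ := by
  have := (Real.summable_one_div_nat_add_rpow ψ 2).mpr (by norm_num)
  refine this.congr fun n => ?_
  rw [abs_of_pos (by positivity), one_div]
  norm_cast

theorem summable_shiftedExpSum (k : ℕ) {s ψ : ℝ} (hs : 0 < s) (hψ : 0 < ψ) :
    Summable fun n : ℕ => ((n : ℝ) + ψ) ^ k * Real.exp (-(2 * Real.pi * s * (n + ψ))) := by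
  refine Summable.of_nonneg_of_le (fun n => by positivity) (fun n => ?_)
    ((summable_shifted_inv_sq hψ).mul_left ((k + 2).factorial / (2 * Real.pi * s) ^ (k + 2) : ℝ))
  exact pow_mul_exp_neg_le (by positivity) (by positivity) k 2

theorem shiftedExpSum_nonneg (k : ℕ) {s ψ : ℝ} (hψ : 0 < ψ) : 0 ≤ shiftedExpSum k s ψ :=
  tsum_nonneg fun n => by positivity

theorem shiftedExpSum_le (k : ℕ) {ψ : ℝ} (hψ : 0 < ψ) :
    ∃ C : ℝ, ∀ s : ℝ, 0 < s → shiftedExpSum k s ψ ≤ C / s ^ (k + 2) := by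
  refine ⟨(k + 2).factorial / (2 * Real.pi) ^ (k + 2) *
    ∑' n : ℕ, (((n : ℝ) + ψ) ^ 2)⁻¹, fun s hs => ?_⟩
  have h := Summable.tsum_le_tsum (fun n : ℕ => pow_mul_exp_neg_le
    (b := 2 * Real.pi * s) (by positivity) (x := n + ψ) (by positivity) k 2)
    (summable_shiftedExpSum k hs hψ) ((summable_shifted_inv_sq hψ).mul_left _)
  rw [tsum_mul_left] at h
  refine h.trans (le_of_eq ?_)
  rw [mul_pow]
  field_simp

theorem isBigO_cocompact_of_le {f : ℝ → ℂ} {C : ℝ} (h : ∀ x : ℝ, x ≠ 0 → ‖f x‖ ≤ C * (|x| ^ 2)⁻¹) :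
    f =O[cocompact ℝ] fun x : ℝ => |x| ^ (-2 : ℝ) := by
  apply Asymptotics.IsBigO.of_bound C
  have : {0}ᶜ ∈ cocompact ℝ := isCompact_singleton.compl_mem_cocompact
  filter_upwards [this] with x hx
  refine (h x hx).trans (le_of_eq ?_)
  rw [Real.norm_of_nonneg (Real.rpow_nonneg (abs_nonneg x) _), Real.rpow_neg (abs_nonneg _)]
  norm_cast

theorem summable_int_inv_pow_add_I_mul {k : ℕ} (hk : 1 ≤ k) (s : ℝ) :
    Summable fun n : ℤ => 1 / ((s : ℂ) + Complex.I * n) ^ (k + 1) := by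
  have h := (Real.summable_abs_int_rpow (b := k + 1)
    (by have : (1 : ℝ) ≤ k := by exact_mod_cast hk
        linarith))
  refine Summable.of_norm_bounded_eventually h ?_
  have : {0}ᶜ ∈ cofinite (α := ℤ) := (finite_singleton 0).compl_mem_cofinite
  filter_upwards [this] with n hn
  have hn0 : (n : ℝ) ≠ 0 := by exact_mod_cast hn
  have h1 : |(n : ℝ)| ≤ ‖(s : ℂ) + Complex.I * n‖ := by
    have := Complex.abs_im_le_norm ((s : ℂ) + Complex.I * n)
    simpa using this
  rw [norm_div, norm_one, norm_pow, Real.rpow_neg (abs_nonneg _), one_div]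
  have h2 : |(n : ℝ)| ^ ((k : ℝ) + 1) = |(n : ℝ)| ^ (k + 1) := by norm_cast
  rw [h2]
  have : 0 < |(n : ℝ)| := abs_pos.mpr hn0
  gcongr

theorem fourier_coe_eq (n : ℤ) (x : ℝ) :
    (fourier n (x : UnitAddCircle) : ℂ) = Complex.exp (2 * Real.pi * Complex.I * n * x) := by
  rw [fourier_coe_apply]
  simp

/-- The Lipschitz summation formula twisted by an additive character, on the imaginary axis. -/
theorem hasSum_twisted_lipschitz {k : ℕ} (hk : 1 ≤ k) {s ψ : ℝ} (hs : 0 < s) (hψ0 : 0 < ψ)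
    (hψ1 : ψ < 1) :
    HasSum (fun n : ℤ => Complex.exp (2 * Real.pi * Complex.I * n * ψ) *
      (1 / ((s : ℂ) + Complex.I * n) ^ (k + 1)))
      ((2 * Real.pi) ^ (k + 1) / k.factorial * (shiftedExpSum k s ψ : ℂ)) := by
  have hpi : (Real.pi : ℂ) ≠ 0 := by exact_mod_cast Real.pi_ne_zero
  -- Truncating with `max` keeps the function continuous, as Poisson summation requires, and `k ≥ 1`
  -- makes it vanish on the negative axis. Its Fourier transform is a Laplace integral at `2π(s +
  -- in)`.
  set f : ℝ → ℂ := fun x => ((max x 0 : ℝ) : ℂ) ^ k * Complex.exp (-(2 * Real.pi * s : ℝ) * x)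
    with hf
  have hneg : ∀ x ≤ 0, f x = 0 := by
    intro x hx
    simp [hf, max_eq_right hx, show k ≠ 0 by omega]
  have hpos : ∀ x : ℝ, 0 < x →
      f x = ((x ^ k * Real.exp (-(2 * Real.pi * s * x)) : ℝ) : ℂ) := by
    intro x hx
    simp [hf, max_eq_left hx.le]
  have hcont : Continuous f := by
    have : Continuous fun x : ℝ => max x 0 := by fun_prop
    fun_prop
  have hdecay : ∀ x : ℝ, x ≠ 0 →
      ‖f x‖ ≤ (k + 2).factorial / (2 * Real.pi * s) ^ (k + 2) * (|x| ^ 2)⁻¹ := by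
    intro x hx
    rcases le_or_gt x 0 with h | h
    · rw [hneg x h, norm_zero]
      positivity
    · rw [hpos x h, Complex.norm_real, Real.norm_eq_abs, abs_of_nonneg (by positivity),
        abs_of_pos h]
      exact pow_mul_exp_neg_le (by positivity) h k 2
  have hF : ∀ n : ℤ, FourierTransform.fourier f (n : ℝ) =
      k.factorial / (2 * Real.pi) ^ (k + 1) * (1 / ((s : ℂ) + Complex.I * n) ^ (k + 1)) := by
    intro n
    have hre : 0 < (2 * Real.pi * ((s : ℂ) + Complex.I * n)).re := by
      simp
      positivity
    have h := integral_pow_mul_cexp_neg k hre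
    rw [Real.fourier_real_eq_integral_exp_smul,
      ← setIntegral_eq_integral_of_forall_compl_eq_zero (s := Ioi (0 : ℝ))
        (fun x hx => by rw [hneg x (not_lt.mp hx), smul_zero])]
    rw [mul_pow] at h
    rw [div_mul_div_comm, mul_one, ← h]
    refine setIntegral_congr_fun measurableSet_Ioi fun x (hx : 0 < x) => ?_
    simp only [hf, smul_eq_mul, max_eq_left hx.le]
    rw [mul_left_comm, ← Complex.exp_add]
    congr 2
    push_cast
    ring
  have hsum := summable_int_inv_pow_add_I_mul hk s
  have hps := Real.tsum_eq_tsum_fourier_of_rpow_decay_of_summable hcont one_lt_two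
    (isBigO_cocompact_of_le hdecay) (by
      simp only [hF]
      exact hsum.mul_left _) ψ
  have hsum2 : Summable fun n : ℤ => Complex.exp (2 * Real.pi * Complex.I * n * ψ) *
      (1 / ((s : ℂ) + Complex.I * n) ^ (k + 1)) := by
    refine Summable.of_norm_bounded hsum.norm fun n => ?_
    rw [norm_mul, show 2 * Real.pi * Complex.I * n * ψ =
      ((2 * Real.pi * n * ψ : ℝ) : ℂ) * Complex.I by push_cast; ring,
      Complex.norm_exp_ofReal_mul_I, one_mul]
  have hleft : ∑' n : ℤ, f (ψ + n) = (shiftedExpSum k s ψ : ℂ) := by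
    have hn : ∀ n : ℕ, f (ψ + (n : ℤ)) =
        ((((n : ℝ) + ψ) ^ k * Real.exp (-(2 * Real.pi * s * (n + ψ))) : ℝ) : ℂ) := by
      intro n
      rw [hpos _ (by push_cast; positivity)]
      push_cast
      rw [add_comm (ψ : ℂ)]
    have hm : ∀ n : ℕ, f (ψ + (-(n + 1 : ℤ) : ℤ)) = 0 := by
      intro n
      apply hneg
      push_cast
      have : (0 : ℝ) ≤ n := n.cast_nonneg
      linarith
    have h1 : HasSum (fun n : ℕ => f (ψ + (n : ℤ))) (shiftedExpSum k s ψ : ℂ) := by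
      simp only [hn]
      exact Complex.hasSum_ofReal.mpr (summable_shiftedExpSum k hs hψ0).hasSum
    have h2 : HasSum (fun n : ℕ => f (ψ + (-(n + 1 : ℤ) : ℤ))) 0 := by
      simp only [hm]
      exact hasSum_zero
    have := HasSum.of_nat_of_neg_add_one (f := fun n : ℤ => f (ψ + n)) h1 h2
    rw [this.tsum_eq, add_zero]
  rw [hleft] at hps
  rw [hps]
  have : ((2 * Real.pi) ^ (k + 1) / k.factorial : ℂ) * ∑' n : ℤ, FourierTransform.fourier f (n : ℝ) *
      (fourier n (ψ : UnitAddCircle) : ℂ) = ∑' n : ℤ,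
      Complex.exp (2 * Real.pi * Complex.I * n * ψ) *
      (1 / ((s : ℂ) + Complex.I * n) ^ (k + 1)) := by
    rw [← tsum_mul_left]
    refine tsum_congr fun n => ?_
    rw [hF, fourier_coe_eq]
    have : (k.factorial : ℂ) ≠ 0 := by exact_mod_cast k.factorial_ne_zero
    field_simp
  rw [this]
  exact hsum2.hasSum

end Lipschitz

/-! ### The even weight in `ξ` and the series giving its Fourier transform. -/

section DivisorTheta

open MeasureTheory Set

/-- Closed form of `∑_{e ≥ 1} cos(2πeψ) e^{-we}`. -/
noncomputable def cosExpSum (ψ w : ℝ) : ℝ :=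
  (Complex.exp (-w + 2 * Real.pi * ψ * Complex.I) /
    (1 - Complex.exp (-w + 2 * Real.pi * ψ * Complex.I))).re

/-- Because `ψ` is not an integer the denominator survives even at `w = 0`. Thus the closed form has
no pole there, and the weight below is continuous at `ξ = 0`. -/
theorem one_sub_cexp_ne_zero {ψ : ℝ} (hψ0 : 0 < ψ) (hψ1 : ψ < 1) (w : ℝ) :
    1 - Complex.exp (-w + 2 * Real.pi * ψ * Complex.I) ≠ 0 := by
  intro h
  obtain ⟨n, hn⟩ := Complex.exp_eq_one_iff.mp (sub_eq_zero.mp h).symm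
  have him := congrArg Complex.im hn
  simp at him
  have h2 : ψ = n := by
    have := Real.pi_pos
    apply mul_left_cancel₀ (show 2 * Real.pi ≠ 0 by positivity)
    linarith
  rw [h2] at hψ0 hψ1
  have h3 : (0 : ℤ) < n := by exact_mod_cast hψ0
  have h4 : n < (1 : ℤ) := by exact_mod_cast hψ1
  omega

theorem continuous_cosExpSum {ψ : ℝ} (hψ0 : 0 < ψ) (hψ1 : ψ < 1) :
    Continuous (cosExpSum ψ) := by
  apply Complex.continuous_re.comp
  refine Continuous.div (by fun_prop) (by fun_prop) fun w => one_sub_cexp_ne_zero hψ0 hψ1 w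

theorem hasSum_cosExpSum (ψ : ℝ) {w : ℝ} (hw : 0 < w) :
    HasSum (fun n : ℕ => Real.cos (2 * Real.pi * (n + 1 : ℕ) * ψ) * Real.exp (-(w * (n + 1 : ℕ))))
      (cosExpSum ψ w) := by
  have hz : ‖Complex.exp (-w + 2 * Real.pi * ψ * Complex.I)‖ < 1 := by
    rw [Complex.norm_exp]
    simpa using hw
  have h := Complex.hasSum_re ((hasSum_geometric_of_norm_lt_one hz).mul_left
    (Complex.exp (-w + 2 * Real.pi * ψ * Complex.I)))
  rw [← div_eq_mul_inv] at h
  convert! h using 1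
  funext n
  rw [← pow_succ', ← Complex.exp_nat_mul, Complex.exp_re]
  simp
  ring_nf

theorem summable_succ_inv_pow {p : ℕ} (hp : 2 ≤ p) :
    Summable fun n : ℕ => (((n + 1 : ℕ) : ℝ) ^ p)⁻¹ :=
  (summable_nat_add_iff 1).mpr (Real.summable_nat_pow_inv.mpr (by omega))

theorem abs_cosExpSum_le (ψ : ℝ) {p : ℕ} (hp : 2 ≤ p) :
    ∃ C : ℝ, 0 ≤ C ∧ ∀ w : ℝ, 0 < w → |cosExpSum ψ w| ≤ C / w ^ p := by
  refine ⟨p.factorial * ∑' n : ℕ, (((n + 1 : ℕ) : ℝ) ^ p)⁻¹,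
    mul_nonneg (by positivity) (tsum_nonneg fun n => by positivity), fun w hw => ?_⟩
  rw [← (hasSum_cosExpSum ψ hw).tsum_eq, ← Real.norm_eq_abs]
  have h := ((summable_succ_inv_pow hp).hasSum.mul_left (p.factorial / w ^ p : ℝ))
  refine (tsum_of_norm_bounded h fun n => ?_).trans (le_of_eq (by ring))
  rw [norm_mul, Real.norm_eq_abs, Real.norm_eq_abs, Real.abs_exp]
  have h1 := Real.exp_neg_le_factorial_div_pow (mul_pos hw (show (0 : ℝ) < (n + 1 : ℕ) by
    positivity)) p
  calc _ ≤ 1 * (p.factorial / (w * (n + 1 : ℕ)) ^ p : ℝ) := by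
        gcongr
        exact Real.abs_cos_le_one _
    _ = _ := by rw [mul_pow]; field_simp

/-- The even function `|ξ|^k ∑_{e ≥ 1} cos(2πeψ) e^{-qe|ξ|}`. -/
noncomputable def cosExpWeight (k : ℕ) (q ψ ξ : ℝ) : ℝ :=
  |ξ| ^ k * cosExpSum ψ (q * |ξ|)

theorem continuous_cosExpWeight (k : ℕ) (q : ℝ) {ψ : ℝ} (hψ0 : 0 < ψ) (hψ1 : ψ < 1) :
    Continuous (cosExpWeight k q ψ) := by
  have := continuous_cosExpSum hψ0 hψ1
  unfold cosExpWeight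
  fun_prop

theorem abs_cosExpWeight_le (k : ℕ) {q : ℝ} (hq : 0 < q) (ψ : ℝ) :
    ∃ C : ℝ, 0 ≤ C ∧ ∀ ξ : ℝ, ξ ≠ 0 → |cosExpWeight k q ψ ξ| ≤ C * (|ξ| ^ 2)⁻¹ := by
  obtain ⟨C, hC0, hC⟩ := abs_cosExpSum_le ψ (p := k + 2) (by omega)
  refine ⟨C / q ^ (k + 2), by positivity, fun ξ hξ => ?_⟩
  have hξ' : 0 < |ξ| := abs_pos.mpr hξ
  rw [cosExpWeight, abs_mul, abs_of_nonneg (by positivity : 0 ≤ |ξ| ^ k)]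
  calc _ ≤ |ξ| ^ k * (C / (q * |ξ|) ^ (k + 2)) := by
        gcongr
        exact hC _ (by positivity)
    _ = _ := by rw [mul_pow, pow_add |ξ|]; field_simp

theorem cosExpWeight_neg (k : ℕ) (q ψ ξ : ℝ) :
    cosExpWeight k q ψ (-ξ) = cosExpWeight k q ψ ξ := by
  simp [cosExpWeight]

theorem norm_cexp_mul_I (x : ℝ) : ‖Complex.exp ((x : ℂ) * Complex.I)‖ = 1 :=
  Complex.norm_exp_ofReal_mul_I x

theorem integrable_cosExpWeight (k : ℕ) {q : ℝ} (hq : 0 < q) {ψ : ℝ} (hψ0 : 0 < ψ) (hψ1 : ψ < 1)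
    (u : ℝ) :
    Integrable fun ξ : ℝ => (cosExpWeight k q ψ ξ : ℂ) *
      Complex.exp (((-(2 * Real.pi * u * ξ) : ℝ) : ℂ) * Complex.I) := by
  have hc := continuous_cosExpWeight k q hψ0 hψ1
  obtain ⟨C, hC0, hC⟩ := abs_cosExpWeight_le k hq ψ
  have hnorm : ∀ ξ : ℝ, ‖(cosExpWeight k q ψ ξ : ℂ) *
      Complex.exp (((-(2 * Real.pi * u * ξ) : ℝ) : ℂ) * Complex.I)‖ = |cosExpWeight k q ψ ξ| := by
    intro ξ
    rw [norm_mul, norm_cexp_mul_I, mul_one, Complex.norm_real, Real.norm_eq_abs]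
  refine LocallyIntegrable.integrable_of_isBigO_atTop_of_norm_isNegInvariant
    (g := fun x : ℝ => x ^ (-2 : ℝ)) (Continuous.locallyIntegrable (by fun_prop)) ?_ ?_
    (integrableAtFilter_rpow_atTop_iff.mpr (by norm_num))
  · filter_upwards with ξ
    simp only [Function.comp_apply]
    rw [hnorm, hnorm, cosExpWeight_neg]
  · apply Asymptotics.IsBigO.of_bound C
    filter_upwards [eventually_gt_atTop 0] with ξ hξ
    rw [hnorm, Real.norm_of_nonneg (by positivity), Real.rpow_neg hξ.le]
    refine (hC ξ hξ.ne').trans (le_of_eq ?_)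
    rw [abs_of_pos hξ]
    norm_cast

theorem I_pow_of_odd {k : ℕ} (hk : Odd k) : Complex.I ^ (k + 1) = (-1) ^ ((k + 1) / 2) := by
  obtain ⟨m, rfl⟩ := hk
  rw [show 2 * m + 1 + 1 = 2 * (m + 1) by ring, pow_mul, Complex.I_sq,
    Nat.mul_div_cancel_left _ two_pos]

/-- The Fourier transform of `cosExpWeight k q ψ` divided by a sign. -/
noncomputable def cosExpDual (k : ℕ) (q ψ u : ℝ) : ℝ :=
  (2 * Real.pi) ^ (k + 1) / (2 * q ^ (k + 1)) *
    (shiftedExpSum k (2 * Real.pi * |u| / q) ψ + shiftedExpSum k (2 * Real.pi * |u| / q) (1 - ψ)) -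
    k.factorial / (2 * Real.pi * |u|) ^ (k + 1)

/-- Adding the Lipschitz formulas for `ψ` and `1 - ψ` and folding `n` with `-n` turns the characters
into cosines. -/
theorem hasSum_cos_mul_inv_pow_of_pos {k : ℕ} (hk : Odd k) {q : ℝ} (hq : 0 < q) {ψ : ℝ}
    (hψ0 : 0 < ψ) (hψ1 : ψ < 1) {u : ℝ} (hu : 0 < u) :
    HasSum (fun n : ℕ => (Real.cos (2 * Real.pi * (n + 1 : ℕ) * ψ) : ℂ) *
      (1 / (q * (n + 1 : ℕ) + 2 * Real.pi * u * Complex.I) ^ (k + 1) +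
        1 / (q * (n + 1 : ℕ) - 2 * Real.pi * u * Complex.I) ^ (k + 1)))
      ((-1) ^ ((k + 1) / 2) * cosExpDual k q ψ u / k.factorial) := by
  set s : ℝ := 2 * Real.pi * u / q with hs
  have hs0 : 0 < s := by positivity
  have hq' : (q : ℂ) ≠ 0 := by exact_mod_cast hq.ne'
  have hfact : (k.factorial : ℂ) ≠ 0 := by exact_mod_cast k.factorial_ne_zero
  have h1 := hasSum_twisted_lipschitz hk.pos hs0 hψ0 hψ1
  have h2 := hasSum_twisted_lipschitz hk.pos hs0 (sub_pos.mpr hψ1) (sub_lt_self 1 hψ0)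
  -- Folding counts index `0` twice, and dropping the folded pair at `0` leaves the full sum minus
  -- one copy of that term. After rescaling this is the subtracted `k!/(2πu)^(k+1)` of `cosExpDual`.
  have h3 := (h1.add h2).nat_add_neg
  rw [← hasSum_nat_add_iff' 1] at h3
  have hI := I_pow_of_odd hk
  have h4 := h3.mul_left ((-1 : ℂ) ^ ((k + 1) / 2) / (2 * q ^ (k + 1)))
  -- With `s = 2πu/q` one has `s + im = (i/q)(qm - 2πiu)`, and `i^(k+1)` is a sign.
  have hps : ∀ n : ℕ, ((s : ℂ) + Complex.I * (n + 1 : ℕ)) ^ (k + 1) =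
      (-1) ^ ((k + 1) / 2) / q ^ (k + 1) *
        (q * (n + 1 : ℕ) - 2 * Real.pi * u * Complex.I) ^ (k + 1) := by
    intro n
    rw [← hI, ← div_pow, ← mul_pow]
    congr 1
    rw [hs]
    push_cast
    field_simp
    linear_combination 2 * Real.pi * u * Complex.I_sq
  have hms : ∀ n : ℕ, ((s : ℂ) + Complex.I * -(n + 1 : ℕ)) ^ (k + 1) =
      (-1) ^ ((k + 1) / 2) / q ^ (k + 1) *
        (q * (n + 1 : ℕ) + 2 * Real.pi * u * Complex.I) ^ (k + 1) := by
    intro n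
    rw [← hI, ← Even.neg_pow (Odd.add_one hk) Complex.I, ← div_pow, ← mul_pow]
    congr 1
    rw [hs]
    push_cast
    field_simp
    linear_combination 2 * Real.pi * u * Complex.I_sq
  convert! h4 using 1
  · funext n
    have e1 : Complex.exp (2 * Real.pi * Complex.I * (n + 1 : ℕ) * (1 - ψ : ℝ)) =
        Complex.exp (-(2 * Real.pi * (n + 1 : ℕ) * ψ) * Complex.I) := by
      rw [Complex.exp_eq_exp_iff_exists_int]
      exact ⟨n + 1, by push_cast; ring⟩
    have e2 : Complex.exp (2 * Real.pi * Complex.I * -(n + 1 : ℕ) * (1 - ψ : ℝ)) =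
        Complex.exp ((2 * Real.pi * (n + 1 : ℕ) * ψ) * Complex.I) := by
      rw [Complex.exp_eq_exp_iff_exists_int]
      exact ⟨-(n + 1), by push_cast; ring⟩
    have e3 : Complex.exp (2 * Real.pi * Complex.I * (n + 1 : ℕ) * ψ) =
        Complex.exp ((2 * Real.pi * (n + 1 : ℕ) * ψ) * Complex.I) := by
      congr 1; ring
    have e4 : Complex.exp (2 * Real.pi * Complex.I * -(n + 1 : ℕ) * ψ) =
        Complex.exp (-(2 * Real.pi * (n + 1 : ℕ) * ψ) * Complex.I) := by
      congr 1; ring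
    have hcos : (Real.cos (2 * Real.pi * (n + 1 : ℕ) * ψ) : ℂ) =
        (Complex.exp ((2 * Real.pi * (n + 1 : ℕ) * ψ) * Complex.I) +
          Complex.exp (-(2 * Real.pi * (n + 1 : ℕ) * ψ) * Complex.I)) / 2 := by
      rw [Complex.ofReal_cos, Complex.cos]
      push_cast
      rfl
    simp only [Int.cast_neg, Int.cast_natCast]
    rw [e1, e2, e3, e4, hcos, hps, hms, one_div, one_div, one_div, one_div, mul_inv, mul_inv,
      inv_div]
    have hne : (-1 : ℂ) ^ ((k + 1) / 2) ≠ 0 := by simp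
    generalize ((q * (n + 1 : ℕ) - 2 * Real.pi * u * Complex.I : ℂ) ^ (k + 1))⁻¹ = A
    generalize ((q * (n + 1 : ℕ) + 2 * Real.pi * u * Complex.I : ℂ) ^ (k + 1))⁻¹ = B
    field_simp
    ring
  · rw [cosExpDual, abs_of_pos hu, ← hs, Finset.sum_range_one]
    have hsq' : (s : ℂ) ^ (k + 1) = (2 * Real.pi * u) ^ (k + 1) / q ^ (k + 1) := by
      rw [hs, ← div_pow]
      push_cast
      rfl
    simp only [Nat.cast_zero, Int.cast_zero, mul_zero, neg_zero, zero_mul, Complex.exp_zero,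
      add_zero, one_mul, hsq']
    push_cast
    have hu' : (u : ℂ) ≠ 0 := by exact_mod_cast hu.ne'
    have hpi : (Real.pi : ℂ) ≠ 0 := by exact_mod_cast Real.pi_ne_zero
    field_simp
    ring

theorem hasSum_cos_mul_inv_pow {k : ℕ} (hk : Odd k) {q : ℝ} (hq : 0 < q) {ψ : ℝ}
    (hψ0 : 0 < ψ) (hψ1 : ψ < 1) {u : ℝ} (hu : u ≠ 0) :
    HasSum (fun n : ℕ => (Real.cos (2 * Real.pi * (n + 1 : ℕ) * ψ) : ℂ) *
      (1 / (q * (n + 1 : ℕ) + 2 * Real.pi * u * Complex.I) ^ (k + 1) +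
        1 / (q * (n + 1 : ℕ) - 2 * Real.pi * u * Complex.I) ^ (k + 1)))
      ((-1) ^ ((k + 1) / 2) * cosExpDual k q ψ u / k.factorial) := by
  rcases lt_or_gt_of_ne hu with h | h
  · have := hasSum_cos_mul_inv_pow_of_pos hk hq hψ0 hψ1 (neg_pos.mpr h)
    have e : cosExpDual k q ψ (-u) = cosExpDual k q ψ u := by simp [cosExpDual]
    rw [e] at this
    refine this.congr_fun fun n => ?_
    push_cast
    ring_nf
  · exact hasSum_cos_mul_inv_pow_of_pos hk hq hψ0 hψ1 h

end DivisorTheta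

/-! ### Poisson summation in `d` and the transformation formula. -/

section DivisorThetaPoisson

open MeasureTheory Set

theorem integral_eq_integral_Ioi_add_neg {f : ℝ → ℂ} (hf : Integrable f) :
    ∫ x, f x = ∫ x in Ioi (0 : ℝ), (f x + f (-x)) := by
  rw [integral_add hf.integrableOn hf.comp_neg.integrableOn, integral_comp_neg_Ioi, neg_zero,
    add_comm, intervalIntegral.integral_Iic_add_Ioi hf.integrableOn hf.integrableOn]

/-- On the half line the weight is expanded in exponentials and integrated termwise. The norms are
`O(n^(-k-1))` with `k + 1 ≥ 2`, and the result is the series of `hasSum_cos_mul_inv_pow`. -/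
theorem integral_cosExpWeight_mul_cexp {k : ℕ} (hk : Odd k) {q : ℝ} (hq : 0 < q) {ψ : ℝ}
    (hψ0 : 0 < ψ) (hψ1 : ψ < 1) {u : ℝ} (hu : u ≠ 0) :
    ∫ ξ : ℝ, (cosExpWeight k q ψ ξ : ℂ) *
      Complex.exp (((-(2 * Real.pi * u * ξ) : ℝ) : ℂ) * Complex.I) =
      (((-1) ^ ((k + 1) / 2) * cosExpDual k q ψ u : ℝ) : ℂ) := by
  have hfact : (k.factorial : ℂ) ≠ 0 := by exact_mod_cast k.factorial_ne_zero
  rw [integral_eq_integral_Ioi_add_neg (integrable_cosExpWeight k hq hψ0 hψ1 u)]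
  set F : ℕ → ℝ → ℂ := fun n x => (Real.cos (2 * Real.pi * (n + 1 : ℕ) * ψ) : ℂ) *
    ((x : ℂ) ^ k * Complex.exp (-(q * (n + 1 : ℕ) + 2 * Real.pi * u * Complex.I) * x) +
     (x : ℂ) ^ k * Complex.exp (-(q * (n + 1 : ℕ) - 2 * Real.pi * u * Complex.I) * x)) with hF
  have hr1 : ∀ n : ℕ, 0 < (q * (n + 1 : ℕ) + 2 * Real.pi * u * Complex.I : ℂ).re := by
    intro n
    simp
    positivity
  have hr2 : ∀ n : ℕ, 0 < (q * (n + 1 : ℕ) - 2 * Real.pi * u * Complex.I : ℂ).re := by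
    intro n
    simp
    positivity
  have hFint : ∀ n, IntegrableOn (F n) (Ioi 0) := fun n =>
    ((integrableOn_pow_mul_cexp_neg k (hr1 n)).add
      (integrableOn_pow_mul_cexp_neg k (hr2 n))).const_mul _
  have hFval : ∀ n, ∫ x in Ioi (0 : ℝ), F n x = k.factorial *
      ((Real.cos (2 * Real.pi * (n + 1 : ℕ) * ψ) : ℂ) *
      (1 / (q * (n + 1 : ℕ) + 2 * Real.pi * u * Complex.I) ^ (k + 1) +
        1 / (q * (n + 1 : ℕ) - 2 * Real.pi * u * Complex.I) ^ (k + 1))) := by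
    intro n
    simp only [hF]
    rw [integral_const_mul, integral_add (integrableOn_pow_mul_cexp_neg k (hr1 n))
      (integrableOn_pow_mul_cexp_neg k (hr2 n)), integral_pow_mul_cexp_neg k (hr1 n),
      integral_pow_mul_cexp_neg k (hr2 n)]
    ring
  have hFnorm : ∀ n, ∫ x in Ioi (0 : ℝ), ‖F n x‖ ≤
      2 * k.factorial / q ^ (k + 1) * (((n + 1 : ℕ) : ℝ) ^ (k + 1))⁻¹ := by
    intro n
    have hb : 0 < q * (n + 1 : ℕ) := by positivity
    have hint : IntegrableOn (fun x : ℝ => x ^ k * Real.exp (-(q * (n + 1 : ℕ)) * x)) (Ioi 0) := by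
      have h := (integrableOn_pow_mul_cexp_neg k (r := ((q * (n + 1 : ℕ) : ℝ) : ℂ))
        (by simpa using hb)).re
      refine IntegrableOn.congr_fun h (fun x _ => ?_) measurableSet_Ioi
      simp only [RCLike.re_to_complex]
      rw [← Complex.ofReal_pow, ← Complex.ofReal_neg, ← Complex.ofReal_mul, ← Complex.ofReal_exp,
        ← Complex.ofReal_mul, Complex.ofReal_re]
    have hval := integral_Ioi_pow_mul_exp_neg k hb
    have hle : ∫ x in Ioi (0 : ℝ), ‖F n x‖ ≤
        ∫ x in Ioi (0 : ℝ), 2 * (x ^ k * Real.exp (-(q * (n + 1 : ℕ)) * x)) := by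
      refine setIntegral_mono_on (hFint n).norm (hint.const_mul 2) measurableSet_Ioi ?_
      intro x (hx : 0 < x)
      simp only [hF]
      rw [norm_mul, Complex.norm_real, Real.norm_eq_abs]
      have h1 : ‖(x : ℂ) ^ k * Complex.exp (-(q * (n + 1 : ℕ) + 2 * Real.pi * u * Complex.I) * x)‖ =
          x ^ k * Real.exp (-(q * (n + 1 : ℕ)) * x) := by
        rw [norm_mul, norm_pow, Complex.norm_real, Real.norm_of_nonneg hx.le, Complex.norm_exp]
        simp
      have h2 : ‖(x : ℂ) ^ k * Complex.exp (-(q * (n + 1 : ℕ) - 2 * Real.pi * u * Complex.I) * x)‖ =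
          x ^ k * Real.exp (-(q * (n + 1 : ℕ)) * x) := by
        rw [norm_mul, norm_pow, Complex.norm_real, Real.norm_of_nonneg hx.le, Complex.norm_exp]
        simp
      calc _ ≤ 1 * (x ^ k * Real.exp (-(q * (n + 1 : ℕ)) * x) +
            x ^ k * Real.exp (-(q * (n + 1 : ℕ)) * x)) := by
            gcongr
            · exact Real.abs_cos_le_one _
            · exact (norm_add_le _ _).trans (by rw [h1, h2])
        _ = _ := by ring
    rw [integral_const_mul, hval, mul_pow] at hle
    refine hle.trans (le_of_eq ?_)
    field_simp
  have hsum : Summable fun n => ∫ x in Ioi (0 : ℝ), ‖F n x‖ := by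
    refine Summable.of_nonneg_of_le (fun n => integral_nonneg fun _ => norm_nonneg _) hFnorm
      ((summable_succ_inv_pow (by have := hk.pos; omega)).mul_left _)
  have hmain := hasSum_integral_of_summable_integral_norm (μ := volume.restrict (Ioi (0 : ℝ)))
    hFint hsum
  simp only [hFval] at hmain
  have hval := hmain.unique
    ((hasSum_cos_mul_inv_pow hk hq hψ0 hψ1 hu).mul_left (k.factorial : ℂ))
  rw [mul_div_cancel₀ _ hfact] at hval
  push_cast
  rw [← hval]
  refine setIntegral_congr_fun measurableSet_Ioi fun x (hx : 0 < x) => ?_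
  have hc := Complex.hasSum_ofReal.mpr (hasSum_cosExpSum ψ (mul_pos hq hx))
  have hc2 := hc.mul_left ((x : ℂ) ^ k *
    (Complex.exp (((-(2 * Real.pi * u * x) : ℝ) : ℂ) * Complex.I) +
      Complex.exp (((2 * Real.pi * u * x : ℝ) : ℂ) * Complex.I)))
  have hterm : ∀ n, F n x = (x : ℂ) ^ k *
    (Complex.exp (((-(2 * Real.pi * u * x) : ℝ) : ℂ) * Complex.I) +
      Complex.exp (((2 * Real.pi * u * x : ℝ) : ℂ) * Complex.I)) *
      ((Real.cos (2 * Real.pi * (n + 1 : ℕ) * ψ) *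
        Real.exp (-(q * x * (n + 1 : ℕ))) : ℝ) : ℂ) := by
    intro n
    have e1 : Complex.exp (-(q * (n + 1 : ℕ) + 2 * Real.pi * u * Complex.I) * x) =
        Complex.exp (((-(2 * Real.pi * u * x) : ℝ) : ℂ) * Complex.I) *
          (Real.exp (-(q * x * (n + 1 : ℕ))) : ℂ) := by
      rw [Complex.ofReal_exp, ← Complex.exp_add]
      congr 1
      push_cast
      ring
    have e2 : Complex.exp (-(q * (n + 1 : ℕ) - 2 * Real.pi * u * Complex.I) * x) =
        Complex.exp (((2 * Real.pi * u * x : ℝ) : ℂ) * Complex.I) *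
          (Real.exp (-(q * x * (n + 1 : ℕ))) : ℂ) := by
      rw [Complex.ofReal_exp, ← Complex.exp_add]
      congr 1
      push_cast
      ring
    simp only [hF]
    rw [e1, e2, Complex.ofReal_mul (Real.cos _)]
    ring
  simp only [hterm]
  rw [hc2.tsum_eq, cosExpWeight_neg, cosExpWeight, abs_of_pos hx]
  push_cast
  rw [mul_neg, neg_neg]
  ring

theorem summable_shifted_inv_pow {p : ℕ} (hp : 2 ≤ p) (ψ : ℝ) (hψ : 0 < ψ) :
    Summable fun n : ℕ => (((n : ℝ) + ψ) ^ p)⁻¹ := by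
  have := (Real.summable_one_div_nat_add_rpow ψ p).mpr (by
    have : (2 : ℝ) ≤ p := by exact_mod_cast hp
    linarith)
  refine this.congr fun n => ?_
  rw [abs_of_pos (by positivity), one_div]
  norm_cast

theorem summable_shiftedExpSum_comp (k : ℕ) {q : ℝ} (hq : 0 < q) {ψ θ : ℝ} (hψ : 0 < ψ)
    (hθ : 0 < θ) :
    Summable fun n : ℕ => shiftedExpSum k (2 * Real.pi * (n + θ) / q) ψ := by
  obtain ⟨C, hC⟩ := shiftedExpSum_le k hψ
  refine Summable.of_nonneg_of_le (fun n => shiftedExpSum_nonneg k hψ)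
    (fun n => hC _ (by positivity)) ?_
  refine ((summable_shifted_inv_pow (p := k + 2) (by omega) θ hθ).mul_left
    (C / (2 * Real.pi / q) ^ (k + 2))).congr fun n => ?_
  rw [show 2 * Real.pi * (n + θ) / q = (2 * Real.pi / q) * (n + θ) by ring, mul_pow]
  field_simp

/-- The two parts of `cosExpDual` are separately summable over `u = n + θ`; the second one produces
the Hurwitz zeta value at `k + 1`. -/
theorem hasSum_cosExpDual {k : ℕ} (hk : 1 ≤ k) {q : ℝ} (hq : 0 < q) {ψ : ℝ}
    (hψ0 : 0 < ψ) (hψ1 : ψ < 1) {θ : ℝ} (hθ : 0 < θ) :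
    HasSum (fun n : ℕ => cosExpDual k q ψ (n + θ))
      ((2 * Real.pi) ^ (k + 1) / (2 * q ^ (k + 1)) *
        (∑' n : ℕ, (shiftedExpSum k (2 * Real.pi * (n + θ) / q) ψ +
          shiftedExpSum k (2 * Real.pi * (n + θ) / q) (1 - ψ))) -
        k.factorial / (2 * Real.pi) ^ (k + 1) * ∑' n : ℕ, (((n : ℝ) + θ) ^ (k + 1))⁻¹) := by
  have h1 := ((summable_shiftedExpSum_comp k hq hψ0 hθ).add
    (summable_shiftedExpSum_comp k hq (sub_pos.mpr hψ1) hθ)).hasSum.mul_left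
    ((2 * Real.pi) ^ (k + 1) / (2 * q ^ (k + 1)))
  have h2 := (summable_shifted_inv_pow (p := k + 1) (by omega) θ hθ).hasSum.mul_left
    (k.factorial / (2 * Real.pi) ^ (k + 1))
  convert! h1.sub h2 using 1
  funext n
  rw [cosExpDual, abs_of_pos (by positivity), mul_pow _ ((n : ℝ) + θ)]
  field_simp

/-- The transformation formula for `∑_{d,e ≥ 1} d^k cos(2πdθ) cos(2πeψ) e^{-qde}`. -/
theorem hasSum_pow_mul_cos_mul_cosExpSum {k : ℕ} (hk : Odd k) {q : ℝ} (hq : 0 < q) {θ ψ : ℝ}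
    (hθ0 : 0 < θ) (hθ1 : θ < 1) (hψ0 : 0 < ψ) (hψ1 : ψ < 1) :
    HasSum (fun n : ℕ => ((n + 1 : ℕ) : ℝ) ^ k * Real.cos (2 * Real.pi * (n + 1 : ℕ) * θ) *
      cosExpSum ψ (q * (n + 1 : ℕ)))
      ((-1) ^ ((k + 1) / 2) / 2 * ((∑' n : ℕ, cosExpDual k q ψ (n + θ)) +
        ∑' n : ℕ, cosExpDual k q ψ (n + (1 - θ)))) := by
  set ε : ℝ := (-1) ^ ((k + 1) / 2)
  have hcw := continuous_cosExpWeight k q hψ0 hψ1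
  obtain ⟨C, hC0, hC⟩ := abs_cosExpWeight_le k hq ψ
  set f : ℝ → ℂ := fun ξ => (cosExpWeight k q ψ ξ : ℂ) *
    Complex.exp (((-(2 * Real.pi * θ * ξ) : ℝ) : ℂ) * Complex.I) with hf
  have hcont : Continuous f := by fun_prop
  have hdecay : ∀ ξ : ℝ, ξ ≠ 0 → ‖f ξ‖ ≤ C * (|ξ| ^ 2)⁻¹ := by
    intro ξ hξ
    rw [hf, norm_mul, norm_cexp_mul_I, mul_one, Complex.norm_real]
    exact hC ξ hξ
  have hne : ∀ n : ℤ, (n : ℝ) + θ ≠ 0 := by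
    intro n h
    have h1 : (-1 : ℝ) < n := by linarith
    have h2 : (n : ℝ) < 0 := by linarith
    have h3 : (-1 : ℤ) < n := by exact_mod_cast h1
    have h4 : n < 0 := by exact_mod_cast h2
    omega
  have hF : ∀ n : ℤ, FourierTransform.fourier f (n : ℝ) =
      ((ε * cosExpDual k q ψ (n + θ) : ℝ) : ℂ) := by
    intro n
    rw [← integral_cosExpWeight_mul_cexp hk hq hψ0 hψ1 (hne n),
      Real.fourier_real_eq_integral_exp_smul]
    congr 1
    funext ξ
    rw [hf, smul_eq_mul, mul_left_comm, ← Complex.exp_add]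
    congr 2
    push_cast
    ring
  -- The dual depends only on `|u|`, so the negative frequencies become the points `n + (1 - θ)`.
  have hneg : ∀ n : ℕ, cosExpDual k q ψ ((-((n : ℤ) + 1) : ℤ) + θ) =
      cosExpDual k q ψ (n + (1 - θ)) := by
    intro n
    have : |(((-((n : ℤ) + 1) : ℤ) : ℝ) + θ)| = |(n : ℝ) + (1 - θ)| := by
      rw [← abs_neg]
      push_cast
      ring_nf
    simp only [cosExpDual, this]
  have hdual : HasSum (fun n : ℤ => ε * cosExpDual k q ψ (n + θ))
      (ε * ((∑' n : ℕ, cosExpDual k q ψ (n + θ)) +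
        ∑' n : ℕ, cosExpDual k q ψ (n + (1 - θ)))) := by
    apply HasSum.mul_left
    apply HasSum.of_nat_of_neg_add_one
    · exact (hasSum_cosExpDual hk.pos hq hψ0 hψ1 hθ0).summable.hasSum
    · simp only [hneg]
      exact (hasSum_cosExpDual hk.pos hq hψ0 hψ1 (sub_pos.mpr hθ1)).summable.hasSum
  have hps := Real.tsum_eq_tsum_fourier_of_rpow_decay_of_summable hcont one_lt_two
    (isBigO_cocompact_of_le hdecay) (by
      simp only [hF]
      exact (Complex.hasSum_ofReal.mpr hdual).summable) 0
  have hright : ∑' n : ℤ, FourierTransform.fourier f (n : ℝ) *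
      (fourier n ((0 : ℝ) : UnitAddCircle) : ℂ) = ((ε * ((∑' n : ℕ, cosExpDual k q ψ (n + θ)) +
        ∑' n : ℕ, cosExpDual k q ψ (n + (1 - θ))) : ℝ) : ℂ) := by
    rw [← (Complex.hasSum_ofReal.mpr hdual).tsum_eq]
    refine tsum_congr fun n => ?_
    rw [hF, fourier_coe_eq]
    simp
  rw [hright] at hps
  have hfsum : Summable fun n : ℤ => f n := by
    refine Summable.of_norm_bounded_eventually
      ((Real.summable_abs_int_rpow (b := 2) one_lt_two).mul_left C) ?_
    have : {0}ᶜ ∈ cofinite (α := ℤ) := (finite_singleton 0).compl_mem_cofinite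
    filter_upwards [this] with n hn
    refine (hdecay n (by exact_mod_cast hn)).trans (le_of_eq ?_)
    rw [Real.rpow_neg (abs_nonneg _)]
    norm_cast
  have hfs : HasSum (fun n : ℤ => f n) ((ε * ((∑' n : ℕ, cosExpDual k q ψ (n + θ)) +
        ∑' n : ℕ, cosExpDual k q ψ (n + (1 - θ))) : ℝ) : ℂ) := by
    rw [← hps]
    simpa only [zero_add] using hfsum.hasSum
  have h := hfs.nat_add_neg
  rw [← hasSum_nat_add_iff' 1] at h
  -- As `k ≥ 1`, no central term appears, and pairing `n` with `-n` leaves twice the sum over `d ≥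
  -- 1`.
  have hf0 : f 0 = 0 := by
    simp [hf, cosExpWeight, hk.pos.ne']
  have hterm : ∀ n : ℕ, f ((n + 1 : ℕ) : ℤ) + f ((-((n + 1 : ℕ) : ℤ) : ℤ)) =
      ((2 * (((n + 1 : ℕ) : ℝ) ^ k * Real.cos (2 * Real.pi * (n + 1 : ℕ) * θ) *
      cosExpSum ψ (q * (n + 1 : ℕ))) : ℝ) : ℂ) := by
    intro n
    have hpos : (0 : ℝ) < (n + 1 : ℕ) := by positivity
    simp only [hf, Int.cast_neg, Int.cast_natCast]
    rw [cosExpWeight_neg, cosExpWeight, abs_of_pos hpos, Complex.ofReal_mul, Complex.ofReal_mul,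
      Complex.ofReal_mul, Complex.ofReal_mul, Complex.ofReal_cos, Complex.cos]
    push_cast
    ring_nf
  simp only [hterm] at h
  simp only [Finset.sum_range_one, Nat.cast_zero, Int.cast_zero, neg_zero, hf0, add_zero,
    sub_zero] at h
  have h2 := (Complex.hasSum_ofReal.mp h).div_const 2
  convert! h2 using 1
  · funext n
    ring
  · ring

end DivisorThetaPoisson

/-! ### Termwise integration of absolutely convergent series. -/

section TermwiseIntegration

open MeasureTheory Set

theorem integrable_of_hasSum {α ι : Type*} [MeasurableSpace α] {μ : Measure α} [Countable ι]
    {F : ι → α → ℂ} {f : α → ℂ} (hF_int : ∀ i, Integrable (F i) μ)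
    (hF_sum : Summable fun i => ∫ a, ‖F i a‖ ∂μ) (h : ∀ᵐ a ∂μ, HasSum (fun i => F i a) (f a)) :
    Integrable f μ := by
  refine ⟨aestronglyMeasurable_of_tendsto_ae (u := (atTop : Filter (Finset ι)))
    (f := fun s a => ∑ i ∈ s, F i a)
    (fun s => Finset.aestronglyMeasurable_fun_sum s fun i _ => (hF_int i).1) h, ?_⟩
  have h1 : ∫⁻ a, ‖f a‖ₑ ∂μ ≤ ∫⁻ a, ∑' i, ‖F i a‖ₑ ∂μ := by
    refine lintegral_mono_ae ?_
    filter_upwards [h] with a ha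
    rw [← ha.tsum_eq]
    exact enorm_tsum_le_tsum_enorm
  rw [hasFiniteIntegral_iff_enorm]
  refine h1.trans_lt ?_
  rw [lintegral_tsum fun i => (hF_int i).1.enorm]
  have h2 : ∀ i, ∫⁻ a, ‖F i a‖ₑ ∂μ = ENNReal.ofReal (∫ a, ‖F i a‖ ∂μ) := fun i =>
    (ofReal_integral_norm_eq_lintegral_enorm (hF_int i)).symm
  simp only [h2]
  rw [← ENNReal.ofReal_tsum_of_nonneg (fun i => integral_nonneg fun _ => norm_nonneg _) hF_sum]
  exact ENNReal.ofReal_lt_top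

theorem hasSum_integral_of_hasSum {α ι : Type*} [MeasurableSpace α] {μ : Measure α} [Countable ι]
    {F : ι → α → ℂ} {f : α → ℂ} (hF_int : ∀ i, Integrable (F i) μ)
    (hF_sum : Summable fun i => ∫ a, ‖F i a‖ ∂μ) (h : ∀ᵐ a ∂μ, HasSum (fun i => F i a) (f a)) :
    HasSum (fun i => ∫ a, F i a ∂μ) (∫ a, f a ∂μ) := by
  have h1 := hasSum_integral_of_summable_integral_norm hF_int hF_sum
  rwa [integral_congr_ae (h.mono fun a ha => ha.tsum_eq)] at h1

end TermwiseIntegration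

/-! ### From double series to divisor sums. -/

section DivisorSums

open Set

/-- Pairs of positive integers correspond to an integer `n` with a factorization `n = de`, and
unconditional summability permits grouping by the product. -/
theorem hasSum_divisors_of_hasSum_prod {w : ℕ → ℕ → ℂ} {s : ℂ} (g : ℕ → ℂ)
    (h : HasSum (fun p : ℕ × ℕ => w (p.1 + 1) (p.2 + 1) * g ((p.1 + 1) * (p.2 + 1))) s) :
    HasSum (fun n : ℕ => (∑ p ∈ (n + 1).divisorsAntidiagonal, w p.1 p.2) * g (n + 1)) s := by
  have h1 : HasSum (fun p : ℕ+ × ℕ+ => w p.1 p.2 * g (p.1 * p.2)) s := by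
    rw [← (Equiv.prodCongr Equiv.pnatEquivNat Equiv.pnatEquivNat).symm.hasSum_iff]
    convert! h using 1
  rw [← sigmaAntidiagonalEquivProd.hasSum_iff] at h1
  have h2 := h1.sigma fun n => hasSum_fintype _
  rw [← Equiv.pnatEquivNat.symm.hasSum_iff] at h2
  convert! h2 using 1
  funext n
  have key : ∀ N : ℕ+, (∑ p ∈ (N : ℕ).divisorsAntidiagonal, w p.1 p.2) * g N =
      ∑ b, ((fun p : ℕ+ × ℕ+ => w p.1 p.2 * g (p.1 * p.2)) ∘ sigmaAntidiagonalEquivProd)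
        ⟨N, b⟩ := by
    intro N
    rw [← Finset.sum_attach, Finset.sum_mul]
    refine Finset.sum_congr rfl fun p _ => ?_
    have hp := Nat.mem_divisorsAntidiagonal.mp p.2
    have e1 : ((sigmaAntidiagonalEquivProd ⟨N, p⟩).1 : ℕ) = p.1.1 := rfl
    have e2 : ((sigmaAntidiagonalEquivProd ⟨N, p⟩).2 : ℕ) = p.1.2 := rfl
    simp only [Function.comp_apply]
    rw [e1, e2, hp.1]
  exact key (Equiv.pnatEquivNat.symm n)

theorem cosCosDivisorSum_eq (k : ℕ) (θ ψ : ℝ) (n : ℕ) :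
    cosCosDivisorSum k θ ψ n = ∑ p ∈ n.divisorsAntidiagonal,
      (p.1 : ℝ) ^ k * Real.cos (2 * Real.pi * p.1 * θ) * Real.cos (2 * Real.pi * p.2 * ψ) := by
  rw [cosCosDivisorSum, Nat.sum_divisorsAntidiagonal (fun d e : ℕ => (d : ℝ) ^ k *
    Real.cos (2 * Real.pi * d * θ) * Real.cos (2 * Real.pi * e * ψ))]
  refine Finset.sum_congr rfl fun d hd => ?_
  have hd' := Nat.dvd_of_mem_divisors hd
  have hd0 : (d : ℝ) ≠ 0 := by
    have := Nat.pos_of_mem_divisors hd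
    positivity
  rw [Nat.cast_div hd' hd0]
  congr 2
  ring

end DivisorSums

/-! ### Both sides of the transformation formula as double series. -/

section ThetaPairs

open Set

/-- The general term is `d^(-2) e^(-k-2)`; this explains the exponent `k + 2` in the exponential
bounds that rely on it. -/
theorem summable_pow_mul_inv_mul_pow (k : ℕ) :
    Summable fun p : ℕ × ℕ => ((p.1 + 1 : ℕ) : ℝ) ^ k *
      ((((p.1 + 1 : ℕ) : ℝ) * (p.2 + 1 : ℕ)) ^ (k + 2))⁻¹ := by
  refine ((summable_succ_inv_pow (p := 2) le_rfl).mul_of_nonneg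
    (summable_succ_inv_pow (p := k + 2) (by omega)) (fun n => by positivity)
    (fun n => by positivity)).congr fun p => ?_
  rw [mul_pow, pow_add ((p.1 + 1 : ℕ) : ℝ)]
  field_simp

theorem hasSum_prod_cos_mul_exp {k : ℕ} (hk : Odd k) {q : ℝ} (hq : 0 < q) {θ ψ : ℝ}
    (hθ0 : 0 < θ) (hθ1 : θ < 1) (hψ0 : 0 < ψ) (hψ1 : ψ < 1) :
    HasSum (fun p : ℕ × ℕ => ((p.1 + 1 : ℕ) : ℝ) ^ k * Real.cos (2 * Real.pi * (p.1 + 1 : ℕ) * θ) *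
      Real.cos (2 * Real.pi * (p.2 + 1 : ℕ) * ψ) *
      Real.exp (-(q * (((p.1 + 1 : ℕ) : ℝ) * (p.2 + 1 : ℕ)))))
      ((-1) ^ ((k + 1) / 2) / 2 * ((∑' n : ℕ, cosExpDual k q ψ (n + θ)) +
        ∑' n : ℕ, cosExpDual k q ψ (n + (1 - θ)))) := by
  have hs : Summable (fun p : ℕ × ℕ => ((p.1 + 1 : ℕ) : ℝ) ^ k *
      Real.cos (2 * Real.pi * (p.1 + 1 : ℕ) * θ) * Real.cos (2 * Real.pi * (p.2 + 1 : ℕ) * ψ) *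
      Real.exp (-(q * (((p.1 + 1 : ℕ) : ℝ) * (p.2 + 1 : ℕ))))) := by
    refine Summable.of_norm_bounded ((summable_pow_mul_inv_mul_pow k).mul_left
      ((k + 2).factorial / q ^ (k + 2) : ℝ)) fun p => ?_
    have hw : 0 < ((p.1 + 1 : ℕ) : ℝ) * (p.2 + 1 : ℕ) := by positivity
    have h1 := Real.exp_neg_le_factorial_div_pow (mul_pos hq hw) (k + 2)
    rw [norm_mul, norm_mul, norm_mul, norm_pow, Real.norm_natCast, Real.norm_eq_abs,
      Real.norm_eq_abs, Real.norm_eq_abs, Real.abs_exp]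
    calc _ ≤ ((p.1 + 1 : ℕ) : ℝ) ^ k * 1 * 1 *
          ((k + 2).factorial / (q * (((p.1 + 1 : ℕ) : ℝ) * (p.2 + 1 : ℕ))) ^ (k + 2)) := by
          gcongr
          · exact Real.abs_cos_le_one _
          · exact Real.abs_cos_le_one _
      _ = _ := by rw [mul_pow q]; field_simp
  have h1 := hs.hasSum.prod_fiberwise (g := fun d : ℕ => ((d + 1 : ℕ) : ℝ) ^ k *
    Real.cos (2 * Real.pi * (d + 1 : ℕ) * θ) * cosExpSum ψ (q * (d + 1 : ℕ))) (fun d => by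
      have hqd : 0 < q * (d + 1 : ℕ) := by positivity
      refine ((hasSum_cosExpSum ψ hqd).mul_left (((d + 1 : ℕ) : ℝ) ^ k *
        Real.cos (2 * Real.pi * (d + 1 : ℕ) * θ))).congr_fun fun e => ?_
      rw [mul_assoc q]
      ring)
  rw [← h1.unique (hasSum_pow_mul_cos_mul_cosExpSum hk hq hθ0 hθ1 hψ0 hψ1)]
  exact hs.hasSum

/-- Summing `v^k e^{-4π²uv/q}` over `u = m + α`, `v = n + β`. -/
theorem hasSum_prod_shiftedExp (k : ℕ) {q : ℝ} (hq : 0 < q) {α β : ℝ} (hα : 0 < α) (hβ : 0 < β) :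
    HasSum (fun p : ℕ × ℕ => ((p.1 : ℝ) + β) ^ k *
      Real.exp (-(4 * Real.pi ^ 2 * (((p.2 : ℝ) + α) * (p.1 + β)) / q)))
      (∑' n : ℕ, shiftedExpSum k (2 * Real.pi * (n + α) / q) β) := by
  have hs : Summable (fun p : ℕ × ℕ => ((p.2 : ℝ) + β) ^ k *
      Real.exp (-(4 * Real.pi ^ 2 * (((p.1 : ℝ) + α) * (p.2 + β)) / q))) := by
    refine Summable.of_nonneg_of_le (fun p => by positivity) (fun p => ?_)
      (((summable_shifted_inv_pow (p := k + 2) (by omega) α hα).mul_of_nonneg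
        (summable_shifted_inv_pow (p := 2) le_rfl β hβ) (fun n => by positivity)
        (fun n => by positivity)).mul_left ((k + 2).factorial / (4 * Real.pi ^ 2 / q) ^ (k + 2) : ℝ))
    have hw : 0 < 4 * Real.pi ^ 2 / q * (((p.1 : ℝ) + α) * (p.2 + β)) := by positivity
    have h1 := Real.exp_neg_le_factorial_div_pow hw (k + 2)
    rw [mul_div_right_comm]
    calc _ ≤ ((p.2 : ℝ) + β) ^ k *
          ((k + 2).factorial / (4 * Real.pi ^ 2 / q * (((p.1 : ℝ) + α) * (p.2 + β))) ^ (k + 2)) := by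
          gcongr
      _ = _ := by
          rw [mul_pow _ (((p.1 : ℝ) + α) * (p.2 + β)), mul_pow ((p.1 : ℝ) + α),
            pow_add ((p.2 : ℝ) + β)]
          field_simp
  have h1 := hs.hasSum.prod_fiberwise
    (g := fun n : ℕ => shiftedExpSum k (2 * Real.pi * (n + α) / q) β) (fun n => by
      have h2 := (summable_shiftedExpSum k (s := 2 * Real.pi * (n + α) / q) (by positivity)
        hβ).hasSum
      refine h2.congr_fun fun m => ?_
      congr 3
      ring)
  -- The fibrewise sum takes the `α` index first, while the theorem lists the `β` index first.
  rw [h1.tsum_eq, ← (Equiv.prodComm ℕ ℕ).hasSum_iff]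
  exact hs.hasSum

end ThetaPairs

/-! ### Gamma integrals with a scaled exponential. -/

section GammaIntegrals

open MeasureTheory Set

theorem integrableOn_cpow_mul_exp_neg {μ : ℂ} (hμ : 0 < μ.re) {r : ℝ} (hr : 0 < r) :
    IntegrableOn (fun t : ℝ => (t : ℂ) ^ (μ - 1) * (Real.exp (-(r * t)) : ℂ)) (Ioi 0) := by
  have h := mellinConvergent_of_isBigO_rpow_exp (a := r) (b := 0) (s := μ) hr
    (f := fun t : ℝ => (Real.exp (-(r * t)) : ℂ))
    ((Continuous.locallyIntegrable (by fun_prop)).locallyIntegrableOn _)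
    (by
      apply Asymptotics.isBigO_of_le
      intro t
      rw [Complex.norm_real, neg_mul])
    (by
      apply Asymptotics.IsBigO.of_bound 1
      filter_upwards [self_mem_nhdsWithin] with t (ht : 0 < t)
      rw [Complex.norm_real, Real.norm_eq_abs, Real.abs_exp]
      simp
      positivity)
    hμ
  simpa [MellinConvergent] using h

theorem integral_cpow_mul_ofReal_exp_neg {μ : ℂ} (hμ : 0 < μ.re) {r : ℝ} (hr : 0 < r) :
    ∫ t in Ioi (0 : ℝ), (t : ℂ) ^ (μ - 1) * (Real.exp (-(r * t)) : ℂ) =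
      Complex.Gamma μ / (r : ℂ) ^ μ := by
  have h := Complex.integral_cpow_mul_exp_neg_mul_Ioi hμ hr
  have harg : (r : ℂ).arg ≠ Real.pi := by
    rw [Complex.arg_ofReal_of_nonneg hr.le]
    exact Real.pi_pos.ne
  rw [one_div, Complex.inv_cpow _ _ harg] at h
  push_cast
  rw [h]
  ring

theorem integral_norm_cpow_mul_exp_neg {μ : ℂ} (hμ : 0 < μ.re) {r : ℝ} (hr : 0 < r) :
    ∫ t in Ioi (0 : ℝ), ‖(t : ℂ) ^ (μ - 1) * (Real.exp (-(r * t)) : ℂ)‖ =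
      Real.Gamma μ.re / r ^ μ.re := by
  have h := Real.integral_rpow_mul_exp_neg_mul_Ioi hμ hr
  rw [one_div, Real.inv_rpow hr.le] at h
  rw [div_eq_inv_mul, ← h]
  refine setIntegral_congr_fun measurableSet_Ioi fun t (ht : 0 < t) => ?_
  rw [norm_mul, norm_cpow_sub_one ht, Complex.norm_real, Real.norm_eq_abs, Real.abs_exp]

end GammaIntegrals

/-! ### Integrating the transformation formula against `t^(ν-1) e^(-t)`. -/

section Assembly

open MeasureTheory Set

theorem ofReal_sqrt_cpow {r : ℝ} (hr : 0 < r) (μ : ℂ) :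
    ((Real.sqrt r : ℝ) : ℂ) ^ μ = (r : ℂ) ^ (μ / 2) := by
  have hs : 0 < Real.sqrt r := Real.sqrt_pos.mpr hr
  have hs' : ((Real.sqrt r : ℝ) : ℂ) ≠ 0 := by exact_mod_cast hs.ne'
  conv_rhs => rw [← Real.mul_self_sqrt hr.le, Complex.ofReal_mul,
    Complex.mul_cpow_ofReal_nonneg hs.le hs.le, ← Complex.cpow_add _ _ hs', add_halves]

theorem natCast_cpow_mul_besselK {a x : ℝ} (ha : 0 < a) (hx : 0 < x) (ν : ℂ) {n : ℕ} (hn : 0 < n) :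
    (n : ℂ) ^ (ν / 2) * besselK ν ((a * Real.sqrt ((n : ℝ) * x) : ℝ) : ℂ) =
      1 / 2 * ((a ^ 2 * x / 4 : ℝ) : ℂ) ^ (-(ν / 2)) *
        macdonaldIntegral ν (a ^ 2 * x / 4 * n) := by
  have hn' : (0 : ℝ) < n := by exact_mod_cast hn
  have hnc : (n : ℂ) ≠ 0 := by exact_mod_cast hn.ne'
  have hy : 0 < a ^ 2 * x / 4 := by positivity
  have h1 : (a * Real.sqrt ((n : ℝ) * x)) ^ 2 / 4 = a ^ 2 * x / 4 * n := by
    rw [mul_pow, Real.sq_sqrt (by positivity)]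
    ring
  have h2 : a * Real.sqrt ((n : ℝ) * x) / 2 = Real.sqrt (a ^ 2 * x / 4 * n) := by
    rw [← h1, show (a * Real.sqrt ((n : ℝ) * x)) ^ 2 / 4 = (a * Real.sqrt ((n : ℝ) * x) / 2) ^ 2 by
      ring, Real.sqrt_sq (by positivity)]
  rw [besselK_eq (by positivity), h1, h2, ofReal_sqrt_cpow (by positivity), neg_div,
    Complex.ofReal_mul (a ^ 2 * x / 4), Complex.mul_cpow_ofReal_nonneg hy.le hn'.le,
    Complex.ofReal_natCast]
  have h3 : (n : ℂ) ^ (ν / 2) * (n : ℂ) ^ (-(ν / 2)) = 1 := by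
    rw [← Complex.cpow_add _ _ hnc, add_neg_cancel, Complex.cpow_zero]
  linear_combination (1 / 2 * ((a ^ 2 * x / 4 : ℝ) : ℂ) ^ (-(ν / 2)) *
    macdonaldIntegral ν (a ^ 2 * x / 4 * n)) * h3

theorem shiftedTerm_eq (k : ℕ) (ν : ℂ) {a x : ℝ} (ha : 0 < a) (hx : 0 < x) (u v : ℝ) :
    shiftedTerm k ν a x u v = ((v ^ k : ℝ) : ℂ) /
      ((4 * Real.pi ^ 2 * (u * v) / (a ^ 2 * x / 4) + 1 : ℝ) : ℂ) ^ (ν + k + 1) := by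
  rw [shiftedTerm, show 16 * Real.pi ^ 2 / a ^ 2 * (u * v / x) + 1 =
    4 * Real.pi ^ 2 * (u * v) / (a ^ 2 * x / 4) + 1 by field_simp; ring]

theorem summable_shifted_inv_rpow {r : ℝ} (hr : 1 < r) {ψ : ℝ} (hψ : 0 < ψ) :
    Summable fun n : ℕ => (((n : ℝ) + ψ) ^ r)⁻¹ := by
  refine ((Real.summable_one_div_nat_add_rpow ψ r).mpr hr).congr fun n => ?_
  rw [abs_of_pos (by positivity), one_div]

/-- Dropping the `+ 1` leaves a constant times `v^(-σ-1) u^(-σ-k-1)`, a product of convergent series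
since `σ > 0`. -/
theorem summable_shifted_div_rpow (k : ℕ) {σ : ℝ} (hσ : 0 < σ) {y : ℝ} (hy : 0 < y) {α β : ℝ}
    (hα : 0 < α) (hβ : 0 < β) :
    Summable fun p : ℕ × ℕ => ((p.1 : ℝ) + β) ^ k /
      (4 * Real.pi ^ 2 * (((p.2 : ℝ) + α) * (p.1 + β)) / y + 1) ^ (σ + k + 1) := by
  have hk : (0 : ℝ) ≤ k := k.cast_nonneg
  refine Summable.of_nonneg_of_le (fun p => by positivity) (fun p => ?_)
    (((summable_shifted_inv_rpow (r := σ + 1) (by linarith) hβ).mul_of_nonneg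
      (summable_shifted_inv_rpow (r := σ + k + 1) (by linarith) hα) (fun n => by positivity)
      (fun n => by positivity)).mul_left ((4 * Real.pi ^ 2 / y) ^ (σ + k + 1))⁻¹)
  have hu : 0 < (p.2 : ℝ) + α := by positivity
  have hv : 0 < (p.1 : ℝ) + β := by positivity
  have e : 4 * Real.pi ^ 2 / y * (((p.2 : ℝ) + α) * (p.1 + β)) =
      4 * Real.pi ^ 2 * (((p.2 : ℝ) + α) * (p.1 + β)) / y := by ring
  calc _ ≤ ((p.1 : ℝ) + β) ^ k /
        (4 * Real.pi ^ 2 / y * (((p.2 : ℝ) + α) * (p.1 + β))) ^ (σ + k + 1) := by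
        rw [e]
        gcongr
        exact le_add_of_nonneg_right zero_le_one
    _ = _ := by
        rw [Real.mul_rpow (by positivity) (by positivity), Real.mul_rpow hu.le hv.le,
          show ((p.1 : ℝ) + β) ^ (σ + k + 1) = ((p.1 : ℝ) + β) ^ (σ + 1) * ((p.1 : ℝ) + β) ^ k by
            rw [← Real.rpow_natCast, ← Real.rpow_add hv]; ring_nf]
        field_simp

theorem norm_div_ofReal_cpow (k : ℕ) (ν : ℂ) {v r : ℝ} (hv : 0 < v) (hr : 0 < r) :
    ‖((v ^ k : ℝ) : ℂ) / (r : ℂ) ^ (ν + k + 1)‖ = v ^ k / r ^ (ν.re + k + 1) := by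
  rw [norm_div, Complex.norm_real, Real.norm_of_nonneg (by positivity),
    Complex.norm_cpow_eq_rpow_re_of_pos hr]
  simp

theorem summable_shiftedTerm (k : ℕ) {ν : ℂ} (hν : 0 < ν.re) {a x : ℝ} (ha : 0 < a) (hx : 0 < x)
    {α β : ℝ} (hα : 0 < α) (hβ : 0 < β) :
    Summable fun p : ℕ × ℕ => shiftedTerm k ν a x ((p.2 : ℝ) + α) ((p.1 : ℝ) + β) := by
  refine Summable.of_norm ?_
  refine (summable_shifted_div_rpow k hν (y := a ^ 2 * x / 4) (by positivity) hα hβ).congr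
    fun p => ?_
  rw [shiftedTerm_eq k ν ha hx, norm_div_ofReal_cpow k ν (by positivity) (by positivity)]

/-- The integrand `t^(ν+k) e^{-t} ∑_{m ≥ 0} ∑_{n ≥ 0} (n+β)^k e^{-4π²(m+α)(n+β)t/y}`. -/
noncomputable def shiftedKernel (k : ℕ) (ν : ℂ) (y α β t : ℝ) : ℂ :=
  (t : ℂ) ^ (ν + k + 1 - 1) * ((Real.exp (-t) *
    ∑' n : ℕ, shiftedExpSum k (2 * Real.pi * (n + α) / (y / t)) β : ℝ) : ℂ)

/-- At `q = y/t` the exponent is linear in `t`, so together with `e^(-t)` each term is a Gamma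
integral with rate `1 + 4π²uv/y`. -/
theorem shiftedKernel_integral (k : ℕ) {ν : ℂ} (hν : 0 < ν.re) {a x : ℝ} (ha : 0 < a) (hx : 0 < x)
    {α β : ℝ} (hα : 0 < α) (hβ : 0 < β) :
    IntegrableOn (shiftedKernel k ν (a ^ 2 * x / 4) α β) (Ioi 0) ∧
    ∫ t in Ioi (0 : ℝ), shiftedKernel k ν (a ^ 2 * x / 4) α β t =
      Complex.Gamma (ν + k + 1) *
        ∑' p : ℕ × ℕ, shiftedTerm k ν a x ((p.2 : ℝ) + α) ((p.1 : ℝ) + β) := by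
  set y : ℝ := a ^ 2 * x / 4 with hy_def
  have hy : 0 < y := by positivity
  have hμ : 0 < (ν + k + 1).re := by
    simp
    positivity
  set r : ℕ × ℕ → ℝ := fun p => 4 * Real.pi ^ 2 * (((p.2 : ℝ) + α) * (p.1 + β)) / y + 1 with hr_def
  have hr : ∀ p, 0 < r p := fun p => by positivity
  set F : ℕ × ℕ → ℝ → ℂ := fun p t => ((((p.1 : ℝ) + β) ^ k : ℝ) : ℂ) *
    ((t : ℂ) ^ (ν + k + 1 - 1) * (Real.exp (-(r p * t)) : ℂ)) with hF
  have hFint : ∀ p, IntegrableOn (F p) (Ioi 0) := fun p =>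
    (integrableOn_cpow_mul_exp_neg hμ (hr p)).const_mul _
  have hFnorm : ∀ p, ∫ t in Ioi (0 : ℝ), ‖F p t‖ =
      Real.Gamma (ν + k + 1).re * (((p.1 : ℝ) + β) ^ k / r p ^ (ν.re + k + 1)) := by
    intro p
    simp only [hF, norm_mul ((((p.1 : ℝ) + β) ^ k : ℝ) : ℂ)]
    rw [integral_const_mul, integral_norm_cpow_mul_exp_neg hμ (hr p), Complex.norm_real,
      Real.norm_of_nonneg (by positivity)]
    simp
    ring
  have hFsum : Summable fun p => ∫ t in Ioi (0 : ℝ), ‖F p t‖ := by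
    simp only [hFnorm]
    exact (summable_shifted_div_rpow k hν hy hα hβ).mul_left _
  have hpt : ∀ᵐ t ∂(volume.restrict (Ioi (0 : ℝ))),
      HasSum (fun p => F p t) (shiftedKernel k ν y α β t) := by
    filter_upwards [ae_restrict_mem measurableSet_Ioi] with t (ht : 0 < t)
    have h1 := Complex.hasSum_ofReal.mpr
      ((hasSum_prod_shiftedExp k (div_pos hy ht) hα hβ).mul_left (Real.exp (-t)))
    refine (h1.mul_left ((t : ℂ) ^ (ν + k + 1 - 1))).congr_fun fun p => ?_
    have e : Real.exp (-(r p * t)) = Real.exp (-t) *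
        Real.exp (-(4 * Real.pi ^ 2 * (((p.2 : ℝ) + α) * (p.1 + β)) / (y / t))) := by
      rw [← Real.exp_add, hr_def]
      congr 1
      field_simp
      ring
    simp only [hF]
    rw [e]
    push_cast
    ring
  refine ⟨integrable_of_hasSum hFint hFsum hpt, ?_⟩
  rw [← (hasSum_integral_of_hasSum hFint hFsum hpt).tsum_eq, ← tsum_mul_left]
  refine tsum_congr fun p => ?_
  simp only [hF]
  rw [integral_const_mul, integral_cpow_mul_ofReal_exp_neg hμ (hr p), shiftedTerm_eq k ν ha hx]
  ring

/-- The right-hand side of the transformation formula at `q`. -/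
noncomputable def dualThetaSum (k : ℕ) (θ ψ q : ℝ) : ℝ :=
  (-1) ^ ((k + 1) / 2) / 2 * ((∑' n : ℕ, cosExpDual k q ψ (n + θ)) +
    ∑' n : ℕ, cosExpDual k q ψ (n + (1 - θ)))

theorem hasSum_cos_mul_macdonaldIntegral {k : ℕ} (hk : Odd k) {ν : ℂ} (hν : 0 < ν.re) {y : ℝ}
    (hy : 0 < y) {θ ψ : ℝ} (hθ0 : 0 < θ) (hθ1 : θ < 1) (hψ0 : 0 < ψ) (hψ1 : ψ < 1) :
    HasSum (fun p : ℕ × ℕ => ((((p.1 + 1 : ℕ) : ℝ) ^ k *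
        Real.cos (2 * Real.pi * (p.1 + 1 : ℕ) * θ) *
        Real.cos (2 * Real.pi * (p.2 + 1 : ℕ) * ψ) : ℝ) : ℂ) *
        macdonaldIntegral ν (y * ((p.1 + 1) * (p.2 + 1) : ℕ)))
      (∫ t in Ioi (0 : ℝ), (t : ℂ) ^ (ν - 1) *
        ((Real.exp (-t) * dualThetaSum k θ ψ (y / t) : ℝ) : ℂ)) := by
  set c : ℕ × ℕ → ℝ := fun p => ((p.1 + 1 : ℕ) : ℝ) ^ k *
    Real.cos (2 * Real.pi * (p.1 + 1 : ℕ) * θ) * Real.cos (2 * Real.pi * (p.2 + 1 : ℕ) * ψ) with hc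
  have hcle : ∀ p, ‖(c p : ℂ)‖ ≤ ((p.1 + 1 : ℕ) : ℝ) ^ k := by
    intro p
    rw [Complex.norm_real, hc, norm_mul, norm_mul, norm_pow, Real.norm_natCast]
    calc _ ≤ ((p.1 + 1 : ℕ) : ℝ) ^ k * 1 * 1 := by
          gcongr
          · exact Real.abs_cos_le_one _
          · exact Real.abs_cos_le_one _
      _ = _ := by ring
  have hY : ∀ p : ℕ × ℕ, 0 < y * ((p.1 + 1) * (p.2 + 1) : ℕ) := fun p => by positivity
  set F : ℕ × ℕ → ℝ → ℂ := fun p t => (c p : ℂ) *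
    ((t : ℂ) ^ (ν - 1) * (Real.exp (-t - y * ((p.1 + 1) * (p.2 + 1) : ℕ) / t) : ℂ)) with hF
  have hFint : ∀ p, IntegrableOn (F p) (Ioi 0) := fun p =>
    (macdonald_integrableOn (hY p) ν).const_mul _
  have hFsum : Summable fun p => ∫ t in Ioi (0 : ℝ), ‖F p t‖ := by
    refine Summable.of_nonneg_of_le (fun p => integral_nonneg fun _ => norm_nonneg _) (fun p => ?_)
      -- Taking `M = k + 2` in the kernel bound yields `(de)^(-k-2)`, enough to absorb the weight
      -- `d^k`.
      ((summable_pow_mul_inv_mul_pow k).mul_left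
        ((k + 2).factorial * Real.Gamma (ν.re + (k + 2 : ℕ)) / y ^ (k + 2) : ℝ))
    simp only [hF, norm_mul (c p : ℂ)]
    rw [integral_const_mul]
    have h1 := integral_norm_macdonald_kernel_le (hY p) ν (M := k + 2) (by positivity)
    have h0 : 0 ≤ ∫ t in Ioi (0 : ℝ), ‖(t : ℂ) ^ (ν - 1) *
        (Real.exp (-t - y * ((p.1 + 1) * (p.2 + 1) : ℕ) / t) : ℂ)‖ :=
      integral_nonneg fun _ => norm_nonneg _
    refine (mul_le_mul (hcle p) h1 h0 (by positivity)).trans (le_of_eq ?_)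
    rw [mul_pow, Nat.cast_mul]
    field_simp
  have hpt : ∀ᵐ t ∂(volume.restrict (Ioi (0 : ℝ))), HasSum (fun p => F p t) ((t : ℂ) ^ (ν - 1) *
        ((Real.exp (-t) * dualThetaSum k θ ψ (y / t) : ℝ) : ℂ)) := by
    filter_upwards [ae_restrict_mem measurableSet_Ioi] with t (ht : 0 < t)
    have h1 := Complex.hasSum_ofReal.mpr
      ((hasSum_prod_cos_mul_exp hk (div_pos hy ht) hθ0 hθ1 hψ0 hψ1).mul_left (Real.exp (-t)))
    refine (h1.mul_left ((t : ℂ) ^ (ν - 1))).congr_fun fun p => ?_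
    have e : Real.exp (-t - y * ((p.1 + 1) * (p.2 + 1) : ℕ) / t) = Real.exp (-t) *
        Real.exp (-(y / t * (((p.1 + 1 : ℕ) : ℝ) * (p.2 + 1 : ℕ)))) := by
      rw [← Real.exp_add]
      congr 1
      push_cast
      ring
    simp only [hF, hc]
    rw [e]
    push_cast
    ring
  refine (hasSum_integral_of_hasSum hFint hFsum hpt).congr_fun fun p => ?_
  simp only [hF]
  rw [integral_const_mul, ← macdonaldIntegral_eq]

/-- The prefactor `q^(-k-1)` at `q = y/t` contributes `t^(k+1)`, raising the Gamma order from `ν` to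
`ν + k + 1`; the zeta part does not depend on `q` and keeps order `ν`. -/
theorem cpow_mul_dualThetaSum {k : ℕ} (hk : 1 ≤ k) (ν : ℂ) {y : ℝ} (hy : 0 < y) {θ ψ : ℝ}
    (hθ0 : 0 < θ) (hθ1 : θ < 1) (hψ0 : 0 < ψ) (hψ1 : ψ < 1) {t : ℝ} (ht : 0 < t) :
    (t : ℂ) ^ (ν - 1) * ((Real.exp (-t) * dualThetaSum k θ ψ (y / t) : ℝ) : ℂ) =
      (-1) ^ ((k + 1) / 2) / 2 * ((2 * Real.pi) ^ (k + 1) / (2 * y ^ (k + 1))) *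
        (shiftedKernel k ν y θ ψ t + shiftedKernel k ν y θ (1 - ψ) t +
          shiftedKernel k ν y (1 - θ) ψ t + shiftedKernel k ν y (1 - θ) (1 - ψ) t) -
      (-1) ^ ((k + 1) / 2) / 2 * (k.factorial / (2 * Real.pi) ^ (k + 1)) *
        (((∑' n : ℕ, (((n : ℝ) + θ) ^ (k + 1))⁻¹) +
          ∑' n : ℕ, (((n : ℝ) + (1 - θ)) ^ (k + 1))⁻¹ : ℝ) : ℂ) *
        ((t : ℂ) ^ (ν - 1) * (Real.exp (-(1 * t)) : ℂ)) := by
  have hq : 0 < y / t := div_pos hy ht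
  have hθ' := sub_pos.mpr hθ1
  have hψ' := sub_pos.mpr hψ1
  have htc : (t : ℂ) ≠ 0 := by exact_mod_cast ht.ne'
  have hyc : (y : ℂ) ≠ 0 := by exact_mod_cast hy.ne'
  have hp : (t : ℂ) ^ (ν + k + 1 - 1) = (t : ℂ) ^ (ν - 1) * (t : ℂ) ^ (k + 1) := by
    rw [← Complex.cpow_natCast, ← Complex.cpow_add _ _ htc]
    congr 1
    push_cast
    ring
  rw [dualThetaSum, (hasSum_cosExpDual hk hq hψ0 hψ1 hθ0).tsum_eq,
    (hasSum_cosExpDual hk hq hψ0 hψ1 hθ').tsum_eq,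
    Summable.tsum_add (summable_shiftedExpSum_comp k hq hψ0 hθ0)
      (summable_shiftedExpSum_comp k hq hψ' hθ0),
    Summable.tsum_add (summable_shiftedExpSum_comp k hq hψ0 hθ')
      (summable_shiftedExpSum_comp k hq hψ' hθ')]
  simp only [shiftedKernel, hp]
  rw [div_pow y, one_mul]
  generalize (∑' n : ℕ, shiftedExpSum k (2 * Real.pi * (n + θ) / (y / t)) ψ) = S₁
  generalize (∑' n : ℕ, shiftedExpSum k (2 * Real.pi * (n + θ) / (y / t)) (1 - ψ)) = S₂
  generalize (∑' n : ℕ, shiftedExpSum k (2 * Real.pi * (n + (1 - θ)) / (y / t)) ψ) = S₃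
  generalize (∑' n : ℕ, shiftedExpSum k (2 * Real.pi * (n + (1 - θ)) / (y / t)) (1 - ψ)) = S₄
  generalize (∑' n : ℕ, (((n : ℝ) + θ) ^ (k + 1))⁻¹) = Z₁
  generalize (∑' n : ℕ, (((n : ℝ) + (1 - θ)) ^ (k + 1))⁻¹) = Z₂
  push_cast
  field_simp
  ring

theorem integral_dualThetaSum {k : ℕ} (hk : 1 ≤ k) {ν : ℂ} (hν : 0 < ν.re) {a x : ℝ} (ha : 0 < a)
    (hx : 0 < x) {θ ψ : ℝ} (hθ0 : 0 < θ) (hθ1 : θ < 1) (hψ0 : 0 < ψ) (hψ1 : ψ < 1) :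
    ∫ t in Ioi (0 : ℝ), (t : ℂ) ^ (ν - 1) *
        ((Real.exp (-t) * dualThetaSum k θ ψ (a ^ 2 * x / 4 / t) : ℝ) : ℂ) =
      (-1) ^ ((k + 1) / 2) / 2 *
        ((2 * Real.pi) ^ (k + 1) / (2 * ((a ^ 2 * x / 4 : ℝ) : ℂ) ^ (k + 1))) *
        (Complex.Gamma (ν + k + 1) * ∑' p : ℕ × ℕ,
          (shiftedTerm k ν a x ((p.2 : ℝ) + θ) ((p.1 : ℝ) + ψ) +
            shiftedTerm k ν a x ((p.2 : ℝ) + θ) ((p.1 : ℝ) + (1 - ψ)) +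
            shiftedTerm k ν a x ((p.2 : ℝ) + (1 - θ)) ((p.1 : ℝ) + ψ) +
            shiftedTerm k ν a x ((p.2 : ℝ) + (1 - θ)) ((p.1 : ℝ) + (1 - ψ)))) -
      (-1) ^ ((k + 1) / 2) / 2 * (k.factorial / (2 * Real.pi) ^ (k + 1)) *
        (((∑' n : ℕ, (((n : ℝ) + θ) ^ (k + 1))⁻¹) +
          ∑' n : ℕ, (((n : ℝ) + (1 - θ)) ^ (k + 1))⁻¹ : ℝ) : ℂ) * Complex.Gamma ν := by
  have hθ' := sub_pos.mpr hθ1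
  have hψ' := sub_pos.mpr hψ1
  have hy : 0 < a ^ 2 * x / 4 := by positivity
  obtain ⟨i1, v1⟩ := shiftedKernel_integral k hν ha hx hθ0 hψ0
  obtain ⟨i2, v2⟩ := shiftedKernel_integral k hν ha hx hθ0 hψ'
  obtain ⟨i3, v3⟩ := shiftedKernel_integral k hν ha hx hθ' hψ0
  obtain ⟨i4, v4⟩ := shiftedKernel_integral k hν ha hx hθ' hψ'
  set K₁ := shiftedKernel k ν (a ^ 2 * x / 4) θ ψ
  set K₂ := shiftedKernel k ν (a ^ 2 * x / 4) θ (1 - ψ)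
  set K₃ := shiftedKernel k ν (a ^ 2 * x / 4) (1 - θ) ψ
  set K₄ := shiftedKernel k ν (a ^ 2 * x / 4) (1 - θ) (1 - ψ)
  have i12 : IntegrableOn (fun t => K₁ t + K₂ t) (Ioi 0) := i1.add i2
  have i123 : IntegrableOn (fun t => K₁ t + K₂ t + K₃ t) (Ioi 0) := i12.add i3
  have i1234 : IntegrableOn (fun t => K₁ t + K₂ t + K₃ t + K₄ t) (Ioi 0) := i123.add i4
  have s1 := summable_shiftedTerm k hν ha hx hθ0 hψ0
  have s2 := summable_shiftedTerm k hν ha hx hθ0 hψ'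
  have s3 := summable_shiftedTerm k hν ha hx hθ' hψ0
  have s4 := summable_shiftedTerm k hν ha hx hθ' hψ'
  have i5 := integrableOn_cpow_mul_exp_neg hν one_pos
  have v5 := integral_cpow_mul_ofReal_exp_neg hν one_pos
  rw [Complex.ofReal_one, Complex.one_cpow, div_one] at v5
  rw [setIntegral_congr_fun measurableSet_Ioi
      (fun t ht => cpow_mul_dualThetaSum hk ν hy hθ0 hθ1 hψ0 hψ1 ht),
    integral_sub (i1234.const_mul _) (i5.const_mul _),
    integral_const_mul, integral_const_mul, integral_add i123 i4, integral_add i12 i3, integral_add i1 i2, v1, v2, v3, v4, v5,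
    Summable.tsum_add ((s1.add s2).add s3) s4, Summable.tsum_add (s1.add s2) s3,
    Summable.tsum_add s1 s2]
  ring

theorem hurwitzZeta_natCast_add_one {k : ℕ} (hk : 1 ≤ k) {θ : ℝ} (hθ0 : 0 < θ) (hθ1 : θ < 1) :
    HurwitzZeta.hurwitzZeta ((θ : ℝ) : UnitAddCircle) ((k : ℂ) + 1) =
      ((∑' n : ℕ, (((n : ℝ) + θ) ^ (k + 1))⁻¹ : ℝ) : ℂ) := by
  have h := HurwitzZeta.hasSum_hurwitzZeta_of_one_lt_re (a := θ) (s := (k : ℂ) + 1)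
    ⟨hθ0.le, hθ1.le⟩ (by simpa using (by omega : 0 < k))
  rw [← h.tsum_eq, Complex.ofReal_tsum]
  refine tsum_congr fun n => ?_
  rw [show (k : ℂ) + 1 = ((k + 1 : ℕ) : ℂ) by push_cast; rfl, Complex.cpow_natCast]
  push_cast
  rw [one_div]

end Assembly

theorem theorem2p12 (k : ℕ) (hk : Odd k) (ν : ℂ) (hν : 0 < ν.re)
    (a x : ℝ) (ha : 0 < a) (hx : 0 < x)
    (θ ψ : ℝ) (hθ0 : 0 < θ) (hθ1 : θ < 1) (hψ0 : 0 < ψ) (hψ1 : ψ < 1) :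
    Summable (fun j : ℕ =>
      ((j + 1 : ℕ) : ℂ) ^ (ν / 2) * besselK ν ((a * Real.sqrt (((j + 1 : ℕ) : ℝ) * x) : ℝ) : ℂ) *
        ((cosCosDivisorSum k θ ψ (j + 1) : ℝ) : ℂ)) ∧
    Summable (fun p : ℕ × ℕ =>
      shiftedTerm k ν a x ((p.2 : ℝ) + θ) ((p.1 : ℝ) + ψ) +
        shiftedTerm k ν a x ((p.2 : ℝ) + θ) ((p.1 : ℝ) + 1 - ψ) +
        shiftedTerm k ν a x ((p.2 : ℝ) + 1 - θ) ((p.1 : ℝ) + ψ) +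
        shiftedTerm k ν a x ((p.2 : ℝ) + 1 - θ) ((p.1 : ℝ) + 1 - ψ)) ∧
    ((a ^ 2 * x / 4 : ℝ) : ℂ) ^ (ν / 2 + (k : ℂ) + 1) *
        (∑' j : ℕ,
          ((j + 1 : ℕ) : ℂ) ^ (ν / 2) *
            besselK ν ((a * Real.sqrt (((j + 1 : ℕ) : ℝ) * x) : ℝ) : ℂ) *
            ((cosCosDivisorSum k θ ψ (j + 1) : ℝ) : ℂ)) =
      (-1 : ℂ) ^ ((k - 1) / 2) * (a : ℂ) ^ (2 * k + 2) * (k.factorial : ℂ) /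
            ((2 : ℂ) ^ (2 * k + 4) * (2 * (Real.pi : ℂ)) ^ (k + 1)) *
          Complex.Gamma ν *
          (HurwitzZeta.hurwitzZeta ((θ : ℝ) : UnitAddCircle) ((k : ℂ) + 1) +
            HurwitzZeta.hurwitzZeta ((1 - θ : ℝ) : UnitAddCircle) ((k : ℂ) + 1)) *
          (x : ℂ) ^ (k + 1) +
        (-1 : ℂ) ^ ((k + 1) / 2) / 8 * (2 * (Real.pi : ℂ)) ^ (k + 1) *
          Complex.Gamma (ν + (k : ℂ) + 1) *
          ∑' p : ℕ × ℕ,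
            (shiftedTerm k ν a x ((p.2 : ℝ) + θ) ((p.1 : ℝ) + ψ) +
              shiftedTerm k ν a x ((p.2 : ℝ) + θ) ((p.1 : ℝ) + 1 - ψ) +
              shiftedTerm k ν a x ((p.2 : ℝ) + 1 - θ) ((p.1 : ℝ) + ψ) +
              shiftedTerm k ν a x ((p.2 : ℝ) + 1 - θ) ((p.1 : ℝ) + 1 - ψ)) := by
  have hθ' := sub_pos.mpr hθ1
  have hψ' := sub_pos.mpr hψ1
  have hy : 0 < a ^ 2 * x / 4 := by positivity
  have hyc : ((a ^ 2 * x / 4 : ℝ) : ℂ) ≠ 0 := by exact_mod_cast hy.ne'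
  have hpi : (Real.pi : ℂ) ≠ 0 := by exact_mod_cast Real.pi_ne_zero
  have hmain := hasSum_divisors_of_hasSum_prod
    (w := fun d e => (((d : ℝ) ^ k * Real.cos (2 * Real.pi * d * θ) *
      Real.cos (2 * Real.pi * e * ψ) : ℝ) : ℂ))
    (fun n => macdonaldIntegral ν (a ^ 2 * x / 4 * n))
    (hasSum_cos_mul_macdonaldIntegral hk hν hy hθ0 hθ1 hψ0 hψ1)
  rw [integral_dualThetaSum hk.pos hν ha hx hθ0 hθ1 hψ0 hψ1] at hmain
  have hLHS := (hmain.mul_left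
    (1 / 2 * ((a ^ 2 * x / 4 : ℝ) : ℂ) ^ (-(ν / 2)))).congr_fun
    (g := fun j : ℕ => ((j + 1 : ℕ) : ℂ) ^ (ν / 2) *
      besselK ν ((a * Real.sqrt (((j + 1 : ℕ) : ℝ) * x) : ℝ) : ℂ) *
        ((cosCosDivisorSum k θ ψ (j + 1) : ℝ) : ℂ)) (fun j => by
      rw [natCast_cpow_mul_besselK ha hx ν j.succ_pos, cosCosDivisorSum_eq, Complex.ofReal_sum]
      ring)
  have e1 : ∀ b c : ℝ, b + 1 - c = b + (1 - c) := fun b c => add_sub_assoc b 1 c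
  simp only [e1]
  refine ⟨hLHS.summable, (((summable_shiftedTerm k hν ha hx hθ0 hψ0).add
    (summable_shiftedTerm k hν ha hx hθ0 hψ')).add
    (summable_shiftedTerm k hν ha hx hθ' hψ0)).add
    (summable_shiftedTerm k hν ha hx hθ' hψ'), ?_⟩
  rw [hLHS.tsum_eq, hurwitzZeta_natCast_add_one hk.pos hθ0 hθ1,
    hurwitzZeta_natCast_add_one hk.pos hθ' (by linarith)]
  have hpow : ((a ^ 2 * x / 4 : ℝ) : ℂ) ^ (ν / 2 + (k : ℂ) + 1) *
      ((a ^ 2 * x / 4 : ℝ) : ℂ) ^ (-(ν / 2)) = ((a ^ 2 * x / 4 : ℝ) : ℂ) ^ (k + 1) := by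
    rw [← Complex.cpow_add _ _ hyc, ← Complex.cpow_natCast]
    congr 1
    push_cast
    ring
  -- This change of sign turns the subtracted zeta term into the added one of the statement.
  have hsign : (-1 : ℂ) ^ ((k + 1) / 2) = -(-1) ^ ((k - 1) / 2) := by
    obtain ⟨m, rfl⟩ := hk
    rw [show (2 * m + 1 + 1) / 2 = m + 1 by omega, show (2 * m + 1 - 1) / 2 = m by omega,
      pow_succ]
    ring
  have hyk : ((a ^ 2 * x / 4 : ℝ) : ℂ) ^ (k + 1) =
      (a : ℂ) ^ (2 * k + 2) * (x : ℂ) ^ (k + 1) / (2 : ℂ) ^ (2 * k + 2) := by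
    rw [show 2 * k + 2 = 2 * (k + 1) by ring, pow_mul, pow_mul, ← mul_pow, ← div_pow]
    congr 1
    push_cast
    ring
  -- Here `A` and `B` are the complex powers of `y`, with product `P = y^(k+1)`, and `T =
  -- (2π)^(k+1)`. The factor `P` cancels in the double series and remains in the zeta term, where it
  -- supplies `a^(2k+2) x^(k+1)`.
  have hstep : ∀ A B P T ε f S Z G : ℂ, A * B = P → P ≠ 0 → T ≠ 0 →
      A * (1 / 2 * B * (ε / 2 * (T / (2 * P)) * S - ε / 2 * (f / T) * Z * G)) =
        ε / 8 * T * S - ε / 4 * P * (f / T) * Z * G := by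
    intro A B P T ε f S Z G hAB hP hT
    rw [show ∀ X : ℂ, A * (1 / 2 * B * X) = A * B * (1 / 2 * X) by intro X; ring, hAB]
    field_simp
    ring
  rw [hstep _ _ _ _ _ _ _ _ _ hpow (pow_ne_zero _ hyc) (pow_ne_zero _ (by simp [hpi])), hyk, hsign,
    Complex.ofReal_add, show 2 * k + 4 = 2 * k + 2 + 2 by ring, pow_add (2 : ℂ) (2 * k + 2)]
  ring
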